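/- **Theorem (invariant/integral manifolds exist).** Let $m,n,\ell\ge 0$, and write $u=(x,y,z)\in\mathbb R^{m}\times\mathbb R^{n}\times\mathbb R^{\ell}$. Consider the non-autonomous system $$\dot x=Ax+f(t,u),\qquad \dot y=By+g(t,u),\qquad \dot z=Cz+h(t,u),\tag{1}$$ given for times $t$ in a non-empty open interval $I\subseteq\mathbb R$ and for states $u$ in a connected open set $d$ containing the origin, with real constant matrices $A,B,C$. Assume that for some real $\alpha\ge 0$, $\beta>0$ and an integer $\mathfrak p\ge 2$: 1. the eigenvalues of $A$, $B$, $C$ satisfy respectively $|\Re\alpha_i|\le\alpha$, $\Re\beta_j\le-\beta$, $\Re\gamma_k\ge\beta$; 2. $\beta>(2\mathfrak p-1)\alpha$; 3. $f,g,h$ are $C^{\mathfrak p}$ in $u\in d$, with all $u$-derivatives up to order $\mathfrak p$ continuous in $(t,u)$, and $f,g,h=O_2$. Here $w(t,u)=O_q$ means $|w(t,u)|=O(|x|^q+|y|^q+|z|^q)$ as $u\to0$, uniformly for $t$ in each compact subinterval of $I$. Then for every order $2\le p\le\mathfrak p$ and every rate $\mu$ with $\alpha<\mu<\beta$ there exist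 a system $\dot u=v(t,u)$, a normal form system for $U=(X,Y,Z)$, $$\dot X=AX+F_c(t,X)+\mathcal F(t,U)YZ,\qquad \dot Y=[B+G(t,U)]Y,\qquad \dot Z=[C+H(t,U)]Z,\tag{2}$$ and a near identity coordinate transform $u=\varphi(t,U)=U+O_2$, such that: * the system $\dot u=v(t,u)$ is $O_p$ close to (1): the difference of $v$ and the right-hand side of (1) is $O_p$; * $F_c$, $\mathcal F$ (a rank three tensor), $G$, $H$ and $\varphi$ are multinomial (in $X$, respectively in $U$), with coefficients that are continuous functions of $t\in I$, continuously differentiable ones for $\varphi$; and $F_c+\mathcal FYZ$, $GY$ and $HZ$ are $O_2$; * the system $\dot u=v(t,u)$ possesses centre, stable, unstable, centre-stable and centre-unstable manifolds in a finite domain over every compact time interval, in the following sense. Let $\mathbb T_\mu=[a,b]\subset I$ with $a<b$. Let $\delta\ge0$ satisfy $\alpha<\mu-\delta$ and $\mu+\delta<\beta$. Let $P,Q,R$ be any invertible real matrices such that $P^{-1}AP$, $Q^{-1}BQ$, $R^{-1}CR$ are in real Jordan form (with $2\times2$ diagonal blocks $\left[\begin{smallmatrix}a&b\\-b&a\end{smallmatrix}\right]$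 for the eigenvalues $a\pm ib$, $b\neq0$) with super-diagonal elements of magnitude at most $\delta$. (Such matrices exist for every $\delta>0$.) Then there are non-empty open sets $D_\mu\subseteq\mathbb D_\mu\subseteq\mathbb R^{m+n+\ell}$, both star-shaped relative to the origin, and open connected sets $d_\mu(t)\subseteq d$, $t\in\mathbb T_\mu$, all containing one common ball centred at the origin, such that - $\alpha<\mu\pm\delta<\beta-\max\{\operatorname{cond}(Q)\|G(t,U)\|,\operatorname{cond}(R)\|H(t,U)\|\}$ for all $t\in\mathbb T_\mu$, $U\in\mathbb D_\mu$, where $\|\cdot\|$ is the matrix 2-norm and $\operatorname{cond}$ the corresponding condition number; - for every $t\in\mathbb T_\mu$, $\varphi(t,\cdot)$ is a $C^{\mathfrak p}$-diffeomorphism from $D_\mu$ onto $d_\mu(t)$; - for $t\in\mathbb T_\mu$ and $u\in d_\mu(t)$, the system $\dot u=v(t,u)$ is the system (2) transformed by $u=\varphi(t,U)$; that is, $v(t,\varphi(t,U))=\partial_t\varphi(t,U)+D_U\varphi(t,U)\,N(t,U)$ for $U\in D_\mu$, where $N$ is the right-hand side of (2); - let $\mathbb M_c,\mathbb M_s,\mathbb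 M_u,\mathbb M_{cs},\mathbb M_{cu}$ be the sets of points of $\mathbb D_\mu$ of the respective forms $(X,0,0)$, $(0,Y,0)$, $(0,0,Z)$, $(X,Y,0)$, $(X,0,Z)$. Then each $\mathcal M_i(t)=\varphi(t,\mathbb M_i\cap D_\mu)\subseteq d_\mu(t)$, $i\in\{c,s,u,cs,cu\}$, is an invariant/integral manifold of $\dot u=v(t,u)$: every solution $u(t)$ on an interval $J\subseteq\mathbb T_\mu$, with $u(t)\in d_\mu(t)$ for all $t\in J$, that lies in $\mathcal M_i(t_0)$ at one time $t_0\in J$ lies in $\mathcal M_i(t)$ for all $t\in J$. -/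

import Mathlib

open Set

noncomputable section

/-- Euclidean space of dimension `k`, with the Euclidean norm. -/
abbrev Vec (k : ℕ) := EuclideanSpace ℝ (Fin k)

/-- The state space of triples (centre, stable, unstable). Its norm is the maximum of the three
Euclidean norms, which is equivalent to the Euclidean norm of the triple; only notions that do not
distinguish equivalent norms are used on it. -/
abbrev State (m n l : ℕ) := Vec m × Vec n × Vec l

/-- A square real matrix acting on Euclidean space. -/
def act {k : ℕ} (M : Matrix (Fin k) (Fin k) ℝ) : Vec k →L[ℝ] Vec k :=
  Matrix.toEuclideanCLM (n := Fin k) (𝕜 := ℝ) M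

/-- The matrix 2-norm (operator norm for the Euclidean norm). -/
def norm2 {k : ℕ} (M : Matrix (Fin k) (Fin k) ℝ) : ℝ := ‖act M‖

/-- The condition number for the matrix 2-norm. -/
def cond2 {k : ℕ} (M : Matrix (Fin k) (Fin k) ℝ) : ℝ := norm2 M⁻¹ * norm2 M

/-! ### Orders, smoothness and multinomials of time dependent functions -/

section TimeDependent

variable {m n l : ℕ} {W : Type*} [NormedAddCommGroup W] [NormedSpace ℝ W]

/-- `w(t,u) = O(|x|^p + |y|^p + |z|^p)` as `u = (x,y,z) → 0`, locally uniformly for times in `I`. -/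
def IsOrder (p : ℕ) (I : Set ℝ) (w : ℝ → State m n l → W) : Prop :=
  ∀ a b : ℝ, Icc a b ⊆ I → ∃ c r : ℝ, 0 < r ∧ ∀ t ∈ Icc a b, ∀ u : State m n l, ‖u‖ < r →
    ‖w t u‖ ≤ c * (‖u.1‖ ^ p + ‖u.2.1‖ ^ p + ‖u.2.2‖ ^ p)

/-- `w` is a time dependent function of class `C^k` on the (open) domain `d`: each `w(t,·)` is `C^k`
on `d`, and its derivatives in the state up to order `k` are continuous in `(t,u)`. -/
def IsClassC (k : ℕ) (I : Set ℝ) (d : Set (State m n l)) (w : ℝ → State m n l → W) : Prop :=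
  (∀ t ∈ I, ContDiffOn ℝ k (w t) d) ∧
  ∀ j ≤ k, ContinuousOn
    (fun q : ℝ × State m n l => iteratedFDeriv ℝ j (w q.1) q.2) (I ×ˢ d)

/-- The `m + n + l` scalar coordinates of a state. -/
def coords (u : State m n l) : Fin m ⊕ Fin n ⊕ Fin l → ℝ :=
  Sum.elim (fun i => u.1 i) (Sum.elim (fun j => u.2.1 j) (fun k => u.2.2 k))

/-- `w` is a multinomial in the coordinates of the state, with coefficients that are functions of
time of class `C^k`. -/
def IsMultinomial (k : ℕ) (I : Set ℝ) (w : ℝ → State m n l → ℝ) : Prop :=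
  ∃ (s : Finset (Fin m ⊕ Fin n ⊕ Fin l → ℕ)) (c : (Fin m ⊕ Fin n ⊕ Fin l → ℕ) → ℝ → ℝ),
    (∀ e ∈ s, ContDiffOn ℝ k (c e) I) ∧
    ∀ t ∈ I, ∀ u, w t u = ∑ e ∈ s, c e t * ∏ i, coords u i ^ e i

end TimeDependent

/-! ### The given system -/

/-- The data of a separated system
`x' = A x + f(t,x,y,z)`, `y' = B y + g(t,x,y,z)`, `z' = C z + h(t,x,y,z)`. -/
structure SeparatedSystem (m n l : ℕ) where
  A : Matrix (Fin m) (Fin m) ℝ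
  B : Matrix (Fin n) (Fin n) ℝ
  C : Matrix (Fin l) (Fin l) ℝ
  f : ℝ → State m n l → Vec m
  g : ℝ → State m n l → Vec n
  h : ℝ → State m n l → Vec l

/-- The right-hand side of a separated system. -/
def SeparatedSystem.field {m n l : ℕ} (S : SeparatedSystem m n l) (t : ℝ) (u : State m n l) :
    State m n l :=
  (act S.A u.1 + S.f t u, act S.B u.2.1 + S.g t u, act S.C u.2.2 + S.h t u)

/-- The standing assumption on a separated system, given for times in the open interval `I` and
states in the domain `d`, with spectral bounds `α`, `β` and order of smoothness `P`. -/
structure SeparatedSystem.Assumption {m n l : ℕ} (S : SeparatedSystem m n l)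
    (I : Set ℝ) (d : Set (State m n l)) (α β : ℝ) (P : ℕ) : Prop where
  time_open : IsOpen I
  time_interval : I.OrdConnected
  time_nonempty : I.Nonempty
  domain_open : IsOpen d
  domain_connected : IsConnected d
  zero_mem : (0 : State m n l) ∈ d
  alpha_nonneg : 0 ≤ α
  beta_pos : 0 < β
  centre : ∀ z ∈ spectrum ℂ (S.A.map Complex.ofReal), |z.re| ≤ α
  stable : ∀ z ∈ spectrum ℂ (S.B.map Complex.ofReal), z.re ≤ -β
  unstable : ∀ z ∈ spectrum ℂ (S.C.map Complex.ofReal), β ≤ z.re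
  two_le : 2 ≤ P
  gap : (2 * (P : ℝ) - 1) * α < β
  smooth_f : IsClassC P I d S.f
  smooth_g : IsClassC P I d S.g
  smooth_h : IsClassC P I d S.h
  order_f : IsOrder 2 I S.f
  order_g : IsOrder 2 I S.g
  order_h : IsOrder 2 I S.h

/-! ### Normal form systems and near identity transforms -/

/-- The nonlinear coefficients of a normal form system
`X' = A X + Fc(t,X) + F(t,U) Y Z`, `Y' = (B + G(t,U)) Y`, `Z' = (C + H(t,U)) Z`, with
`U = (X,Y,Z)`. -/
structure NormalForm (m n l : ℕ) where
  Fc : ℝ → Vec m → Vec m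
  F : ℝ → State m n l → Fin m → Fin n → Fin l → ℝ
  G : ℝ → State m n l → Matrix (Fin n) (Fin n) ℝ
  H : ℝ → State m n l → Matrix (Fin l) (Fin l) ℝ

namespace NormalForm

variable {m n l : ℕ}

/-- The nonlinear part `Fc(t,X) + F(t,U) Y Z` of the centre equation. -/
def centre (N : NormalForm m n l) (t : ℝ) (U : State m n l) : Vec m :=
  N.Fc t U.1 + WithLp.toLp 2 (fun i => ∑ j, ∑ k, N.F t U i j k * U.2.1 j * U.2.2 k)

/-- The right-hand side of the normal form system. -/
def field (N : NormalForm m n l) (A : Matrix (Fin m) (Fin m) ℝ) (B : Matrix (Fin n) (Fin n) ℝ)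
    (C : Matrix (Fin l) (Fin l) ℝ) (t : ℝ) (U : State m n l) : State m n l :=
  (act A U.1 + N.centre t U, act (B + N.G t U) U.2.1, act (C + N.H t U) U.2.2)

/-- The normal form is multinomial, with continuous coefficients, and its nonlinear terms are of
second order. -/
structure IsAdmissible (N : NormalForm m n l) (I : Set ℝ) : Prop where
  multinomial_Fc : ∀ i, IsMultinomial 0 I (fun t (U : State m n l) => N.Fc t U.1 i)
  multinomial_F : ∀ i j k, IsMultinomial 0 I (fun t U => N.F t U i j k)
  multinomial_G : ∀ i j, IsMultinomial 0 I (fun t U => N.G t U i j)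
  multinomial_H : ∀ i j, IsMultinomial 0 I (fun t U => N.H t U i j)
  order_centre : IsOrder 2 I N.centre
  order_G : IsOrder 2 I (fun t U => act (N.G t U) U.2.1)
  order_H : IsOrder 2 I (fun t U => act (N.H t U) U.2.2)

end NormalForm

/-- `φ` is a near identity, multinomial, time dependent coordinate transform `u = φ(t,U)`, with
coefficients that are continuously differentiable in time. -/
structure IsNearIdentity {m n l : ℕ} (I : Set ℝ) (φ : ℝ → State m n l → State m n l) : Prop where
  multinomial : ∀ i, IsMultinomial 1 I (fun t U => coords (φ t U) i)
  near_identity : IsOrder 2 I (fun t U => φ t U - U)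

/-! ### Real Jordan forms -/

/-- A real Jordan block with eigenvalue `a` and super-diagonal elements `e`. -/
def realBlock (s : ℕ) (a : ℝ) (e : ℕ → ℝ) : Matrix (Fin s) (Fin s) ℝ :=
  Matrix.of fun i j =>
    if i = j then a else if (i : ℕ) + 1 = (j : ℕ) then e i else 0

/-- A real Jordan block for the pair of eigenvalues `a ± b i`: the `2 × 2` blocks on the diagonal are
`[a, b; -b, a]` and those above it are `e r` times the identity. -/
def pairBlock (s : ℕ) (a b : ℝ) (e : ℕ → ℝ) : Matrix (Fin (2 * s)) (Fin (2 * s)) ℝ :=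
  Matrix.of fun i j =>
    if (i : ℕ) / 2 = (j : ℕ) / 2 then
      (if i = j then a else if i < j then b else -b)
    else if (i : ℕ) / 2 + 1 = (j : ℕ) / 2 ∧ (i : ℕ) % 2 = (j : ℕ) % 2 then e ((i : ℕ) / 2) else 0

/-- The matrix is in real Jordan form, with super-diagonal elements of magnitude at most `δ`. -/
inductive IsRealJordan (δ : ℝ) : (k : ℕ) → Matrix (Fin k) (Fin k) ℝ → Prop
  | nil : IsRealJordan δ 0 0
  | real (s k : ℕ) (a : ℝ) (e : ℕ → ℝ) (he : ∀ i, |e i| ≤ δ) (J : Matrix (Fin k) (Fin k) ℝ)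
      (hJ : IsRealJordan δ k J) :
      IsRealJordan δ (s + k) (Matrix.reindex finSumFinEquiv finSumFinEquiv
        (Matrix.fromBlocks (realBlock s a e) 0 0 J))
  | pair (s k : ℕ) (a b : ℝ) (hb : b ≠ 0) (e : ℕ → ℝ) (he : ∀ i, |e i| ≤ δ)
      (J : Matrix (Fin k) (Fin k) ℝ) (hJ : IsRealJordan δ k J) :
      IsRealJordan δ (2 * s + k) (Matrix.reindex finSumFinEquiv finSumFinEquiv
        (Matrix.fromBlocks (pairBlock s a b e) 0 0 J))

/-- `P` transforms `A` to real Jordan form with super-diagonal elements of magnitude at most `δ`. -/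
def Jordanizes (δ : ℝ) {k : ℕ} (P A : Matrix (Fin k) (Fin k) ℝ) : Prop :=
  IsUnit P.det ∧ IsRealJordan δ k (P⁻¹ * A * P)

/-! ### Domains -/

section Domains

variable {m n l : ℕ}

/-- A non-empty open set that is star-shaped relative to the origin. -/
def IsStarShaped (D : Set (State m n l)) : Prop :=
  IsOpen D ∧ D.Nonempty ∧ StarConvex ℝ 0 D

/-- The star-shaped set `DD` is an emergence preserving domain over the times `T` for the rate `μ`:
`α < μ ± δ < β - max (cond Q ‖G(t,U)‖) (cond R ‖H(t,U)‖)`. -/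
def IsEmergencePreserving (N : NormalForm m n l) (α β μ δ : ℝ)
    (Q : Matrix (Fin n) (Fin n) ℝ) (R : Matrix (Fin l) (Fin l) ℝ)
    (T : Set ℝ) (DD : Set (State m n l)) : Prop :=
  IsStarShaped DD ∧ ∀ t ∈ T, ∀ U ∈ DD, ∀ ν ∈ ({μ - δ, μ + δ} : Set ℝ),
    α < ν ∧ ν < β - max (cond2 Q * norm2 (N.G t U)) (cond2 R * norm2 (N.H t U))

/-- `φ` restricts to a `C^k`-diffeomorphism from the open set `D` onto the open set `D'`. -/
def IsDiffeoOnto (k : ℕ) (φ : State m n l → State m n l) (D D' : Set (State m n l)) : Prop :=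
  IsOpen D ∧ IsOpen D' ∧ BijOn φ D D' ∧ ContDiffOn ℝ k φ D ∧
    ∃ ψ : State m n l → State m n l, InvOn ψ φ D D' ∧ ContDiffOn ℝ k ψ D'

/-- The vector field `v` is, at the states `φ(t,U)` with `t ∈ T` and `U ∈ D`, the vector field of the
system obtained from `U' = N(t,U)` by the time dependent change of coordinates `u = φ(t,U)`. -/
def IsPushforward (v φ N : ℝ → State m n l → State m n l) (T : Set ℝ) (D : Set (State m n l)) :
    Prop :=
  ∀ t ∈ T, ∀ U ∈ D, v t (φ t U) = deriv (fun s => φ s U) t + fderiv ℝ (φ t) U (N t U)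

end Domains

/-! ### Invariant/integral manifolds -/

/-- The five kinds of invariant manifold. -/
inductive ManifoldKind
  | centre
  | stable
  | unstable
  | centreStable
  | centreUnstable

section Manifolds

variable {m n l : ℕ}

/-- The coordinate subspace of each kind. -/
def ManifoldKind.subspace : ManifoldKind → Set (State m n l)
  | .centre => {U | U.2.1 = 0 ∧ U.2.2 = 0}
  | .stable => {U | U.1 = 0 ∧ U.2.2 = 0}
  | .unstable => {U | U.1 = 0 ∧ U.2.1 = 0}
  | .centreStable => {U | U.2.2 = 0}
  | .centreUnstable => {U | U.2.1 = 0}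

/-- The manifold of each kind of a normal form system, in the domain `DD`. -/
def ManifoldKind.normal (i : ManifoldKind) (DD : Set (State m n l)) : Set (State m n l) :=
  i.subspace ∩ DD

/-- The manifold at time `t` of each kind in the original state space. -/
def ManifoldKind.image (i : ManifoldKind) (φ : ℝ → State m n l → State m n l)
    (DD D : Set (State m n l)) (t : ℝ) : Set (State m n l) :=
  φ t '' (i.normal DD ∩ D)

/-- The time dependent set `M` is invariant for `u' = v(t,u)` in the domain `D'(t)` over the times
`T`: every solution that stays in the domain and is in `M` at one time, is in `M` at all times. -/
def IsIntegralIn (v : ℝ → State m n l → State m n l) (T : Set ℝ)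
    (D' M : ℝ → Set (State m n l)) : Prop :=
  (∀ t ∈ T, M t ⊆ D' t) ∧
  ∀ (J : Set ℝ) (w : ℝ → State m n l), J ⊆ T → J.OrdConnected →
    (∀ t ∈ J, w t ∈ D' t ∧ HasDerivWithinAt w (v t (w t)) J t) →
    ∀ t₀ ∈ J, w t₀ ∈ M t₀ → ∀ t ∈ J, w t ∈ M t

end Manifolds

end

noncomputable section

open MvPolynomial

section Residual

variable {σ R : Type*} [CommRing R]

lemma pderiv_mem_pow_idealOfVars {k : ℕ} {q : MvPolynomial σ R} (i : σ)
    (hq : q ∈ idealOfVars σ R ^ (k + 1)) : pderiv i q ∈ idealOfVars σ R ^ k := by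
  classical
  rw [mem_pow_idealOfVars_iff'] at hq ⊢
  intro e he
  rw [coeff_pderiv, hq _ (by simp [Finsupp.degree_single]; omega), zero_mul]

lemma map_mem_pow_idealOfVars {S : Type*} [CommRing S] (ρ : R →+* S) {k : ℕ}
    {q : MvPolynomial σ R} (hq : q ∈ idealOfVars σ R ^ k) :
    map ρ q ∈ idealOfVars σ S ^ k := by
  rw [mem_pow_idealOfVars_iff'] at hq ⊢
  intro e he
  rw [coeff_map, hq e he, map_zero]

/-- If `φ` and `η` have no constant terms and `η` has order `k`, then `f(φ + η) - f(φ)` has order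
`k + 1` for every `f` of second order. -/
lemma bind₁_add_sub_bind₁_mem {k : ℕ} {φ η : σ → MvPolynomial σ R}
    (hφ : ∀ i, φ i ∈ idealOfVars σ R) (hη : ∀ i, η i ∈ idealOfVars σ R)
    (hηk : ∀ i, η i ∈ idealOfVars σ R ^ k)
    {f : MvPolynomial σ R} (hf : f ∈ idealOfVars σ R ^ 2) :
    bind₁ (φ + η) f - bind₁ φ f ∈ idealOfVars σ R ^ (k + 1) := by
  set 𝔪 := idealOfVars σ R
  have h1 : ∀ p : MvPolynomial σ R, bind₁ (φ + η) p - bind₁ φ p ∈ 𝔪 ^ k := by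
    intro p
    induction p using MvPolynomial.induction_on with
    | C a => simp
    | add p q hp hq =>
      rw [map_add, map_add, add_sub_add_comm]
      exact add_mem hp hq
    | mul_X p i hp =>
      have : bind₁ (φ + η) (p * X i) - bind₁ φ (p * X i) =
          (bind₁ (φ + η) p - bind₁ φ p) * (φ i + η i) + bind₁ φ p * η i := by
        simp only [map_mul, bind₁_X_right, Pi.add_apply]
        ring
      rw [this]
      exact add_mem (Ideal.mul_mem_right _ _ hp) (Ideal.mul_mem_left _ _ (hηk i))
  have h2 : ∀ ψ : σ → MvPolynomial σ R, (∀ i, ψ i ∈ 𝔪) → ∀ p ∈ 𝔪, bind₁ ψ p ∈ 𝔪 := by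
    intro ψ hψ p hp
    have : 𝔪 ≤ 𝔪.comap (bind₁ ψ) := by
      refine Ideal.span_le.2 ?_
      rintro _ ⟨i, rfl⟩
      simpa using hψ i
    exact this hp
  rw [pow_two] at hf
  refine Submodule.mul_induction_on hf ?_ ?_
  · intro p hp q hq
    have : bind₁ (φ + η) (p * q) - bind₁ φ (p * q) =
        (bind₁ (φ + η) p - bind₁ φ p) * bind₁ (φ + η) q +
          (bind₁ (φ + η) q - bind₁ φ q) * bind₁ φ p := by
      simp only [map_mul]
      ring
    rw [this, pow_succ]
    exact add_mem
      (Ideal.mul_mem_mul (h1 p) (h2 _ (fun i => add_mem (hφ i) (hη i)) q hq))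
      (Ideal.mul_mem_mul (h1 q) (h2 _ hφ p hp))
  · intro p q hp hq
    rw [map_add, map_add, add_sub_add_comm]
    exact add_mem hp hq

variable [Fintype σ]

/-- The linear vector field with matrix `L`, as a tuple of linear polynomials. -/
def linearField (L : Matrix σ σ R) (i : σ) : MvPolynomial σ R := ∑ j, C (L i j) * X j

/-- The residual of the conjugacy equation `∂ₜφ + Dφ · (L U + ν) = L φ + f(φ)`, where `φ'` stands for
the time derivative of `φ`. -/
def conjResidual (L : Matrix σ σ R) (f φ φ' ν : σ → MvPolynomial σ R) (i : σ) : MvPolynomial σ R :=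
  φ' i + ∑ j, pderiv j (φ i) * (linearField L j + ν j) - ∑ j, C (L i j) * φ j - bind₁ φ (f i)

/-- The homological operator `η ↦ Dη · L U - L η`. -/
def homological (L : Matrix σ σ R) : (σ → MvPolynomial σ R) →ₗ[R] (σ → MvPolynomial σ R) where
  toFun η i := ∑ j, pderiv j (η i) * linearField L j - ∑ j, C (L i j) * η j
  map_add' η ζ := by
    funext i
    simp only [Pi.add_apply, map_add, add_mul, mul_add, Finset.sum_add_distrib]
    ring
  map_smul' c η := by
    funext i
    simp only [Pi.smul_apply, RingHom.id_apply, smul_sub, Finset.smul_sum,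
      smul_mul_assoc, mul_smul_comm, Derivation.map_smul]

lemma homological_apply (L : Matrix σ σ R) (η : σ → MvPolynomial σ R) (i : σ) :
    homological L η i = ∑ j, pderiv j (η i) * linearField L j - ∑ j, C (L i j) * η j := rfl

section Map

variable {S : Type*} [CommRing S] (ρ : R →+* S)

lemma map_linearField (L : Matrix σ σ R) (i : σ) :
    map ρ (linearField L i) = linearField (L.map ρ) i := by
  simp [linearField, map_sum]

lemma map_homological (L : Matrix σ σ R) (η : σ → MvPolynomial σ R) (i : σ) :
    map ρ (homological L η i) = homological (L.map ρ) (fun i => map ρ (η i)) i := by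
  simp [homological_apply, map_sum, map_linearField, pderiv_map]

end Map

lemma linearField_mem (L : Matrix σ σ R) (i : σ) : linearField L i ∈ idealOfVars σ R :=
  Ideal.sum_mem _ fun j _ => Ideal.mul_mem_left _ _ (Ideal.subset_span ⟨j, rfl⟩)

lemma homological_mem {k : ℕ} (L : Matrix σ σ R) {η : σ → MvPolynomial σ R}
    (hη : ∀ i, η i ∈ idealOfVars σ R ^ (k + 1)) (i : σ) :
    homological L η i ∈ idealOfVars σ R ^ (k + 1) := by
  rw [homological_apply]
  refine sub_mem (Ideal.sum_mem _ fun j _ => ?_)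
    (Ideal.sum_mem _ fun j _ => Ideal.mul_mem_left _ _ (hη j))
  rw [pow_succ]
  exact Ideal.mul_mem_mul (pderiv_mem_pow_idealOfVars j (hη i)) (linearField_mem L j)

/-- To leading order, the residual changes by `∂ₜη + Dη · L U - L η + ζ` when `φ` changes by `η` and
`ν` by `ζ`. -/
theorem conjResidual_add_mem [DecidableEq σ] {k : ℕ} (hk : 2 ≤ k) (L : Matrix σ σ R)
    {f φ φ' ν η η' ζ : σ → MvPolynomial σ R}
    (hf : ∀ i, f i ∈ idealOfVars σ R ^ 2)
    (hφ : ∀ i, φ i - X i ∈ idealOfVars σ R ^ 2)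
    (hν : ∀ i, ν i ∈ idealOfVars σ R ^ 2)
    (hη : ∀ i, η i ∈ idealOfVars σ R ^ k) (hζ : ∀ i, ζ i ∈ idealOfVars σ R ^ k) (i : σ) :
    conjResidual L f (φ + η) (φ' + η') (ν + ζ) i -
      (conjResidual L f φ φ' ν i + (η' i + homological L η i + ζ i)) ∈ idealOfVars σ R ^ (k + 1) := by
  set 𝔪 := idealOfVars σ R
  obtain ⟨k, rfl⟩ : ∃ j, k = j + 2 := ⟨k - 2, by omega⟩
  have hle : ∀ {a b : ℕ} {p : MvPolynomial σ R}, a ≤ b → p ∈ 𝔪 ^ b → p ∈ 𝔪 ^ a :=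
    fun h hp => Ideal.pow_le_pow_right h hp
  have hX : ∀ i, (X i : MvPolynomial σ R) ∈ 𝔪 := fun i => Ideal.subset_span ⟨i, rfl⟩
  have hφ1 : ∀ i, φ i ∈ 𝔪 := fun i => by
    have := add_mem (hle (a := 1) (by omega) (hφ i)) (by simpa using hX i)
    simpa using this
  have hη1 : ∀ i, η i ∈ 𝔪 := fun i => by simpa using hle (a := 1) (by omega) (hη i)
  have hb := bind₁_add_sub_bind₁_mem hφ1 hη1 hη (hf i)
  have key : conjResidual L f (φ + η) (φ' + η') (ν + ζ) i -
      (conjResidual L f φ φ' ν i + (η' i + homological L η i + ζ i)) =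
      ∑ j, (pderiv j (η i) * ν j + pderiv j (η i) * ζ j + pderiv j (φ i - X i) * ζ j) -
        (bind₁ (φ + η) (f i) - bind₁ φ (f i)) := by
    have h1 : ∑ j, pderiv j (X i : MvPolynomial σ R) * ζ j = ζ i := by
      simp [pderiv_X, Pi.single_apply]
    simp only [conjResidual, homological_apply, Pi.add_apply, map_add, map_sub, add_mul, sub_mul,
      mul_add, Finset.sum_add_distrib, Finset.sum_sub_distrib, h1]
    ring
  rw [key]
  refine sub_mem (Ideal.sum_mem _ fun j _ => add_mem (add_mem ?_ ?_) ?_) hb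
  · have := Ideal.mul_mem_mul (pderiv_mem_pow_idealOfVars j (hη i)) (hν j)
    rwa [← pow_add] at this
  · have := Ideal.mul_mem_mul (pderiv_mem_pow_idealOfVars j (hη i)) (hζ j)
    rw [← pow_add] at this
    exact hle (by omega) this
  · have := Ideal.mul_mem_mul (pderiv_mem_pow_idealOfVars (k := 1) j (hφ i)) (hζ j)
    rw [← pow_add] at this
    exact hle (by omega) this

end Residual

/-- Solvability of a linear equation with constant coefficients and continuous inhomogeneity. -/
theorem exists_hasDerivAt_linear {V : Type*} [NormedAddCommGroup V] [NormedSpace ℝ V]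
    [CompleteSpace V] (K : V →L[ℝ] V) {I : Set ℝ} (hI : IsOpen I) (hI' : I.OrdConnected)
    (hne : I.Nonempty) {b : ℝ → V} (hb : ContinuousOn b I) :
    ∃ c : ℝ → V, ∀ t ∈ I, HasDerivAt c (-(K (c t) + b t)) t := by
  obtain ⟨t₀, ht₀⟩ := hne
  have hexp : ∀ (L : V →L[ℝ] V) (t : ℝ),
      HasDerivAt (fun s : ℝ => NormedSpace.exp (s • L)) (L * NormedSpace.exp (t • L)) t :=
    fun L t => hasDerivAt_exp_smul_const' L t
  set g : ℝ → V := fun s => NormedSpace.exp (s • K) (-(b s)) with hg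
  have hgc : ContinuousOn g I := by
    refine ContinuousOn.clm_apply ?_ hb.neg
    exact fun s _ => (hexp K s).continuousAt.continuousWithinAt
  refine ⟨fun t => NormedSpace.exp (t • (-K)) (∫ s in t₀..t, g s), fun t ht => ?_⟩
  have hint : HasDerivAt (fun u => ∫ s in t₀..u, g s) (g t) t := by
    refine intervalIntegral.integral_hasDerivAt_right ?_
      (hgc.stronglyMeasurableAtFilter hI t ht) (hgc.continuousAt (hI.mem_nhds ht))
    exact (hgc.mono (hI'.uIcc_subset ht₀ ht)).intervalIntegrable
  have h := (hexp (-K) t).clm_apply hint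
  have hinv : NormedSpace.exp (t • (-K)) * NormedSpace.exp (t • K) = (1 : V →L[ℝ] V) := by
    let _ : NormedAlgebra ℚ (V →L[ℝ] V) := .restrictScalars ℚ ℝ _
    rw [← NormedSpace.exp_add_of_commute]
    · simp
    · exact ((Commute.refl K).neg_left.smul_left t).smul_right t
  have hinv' : NormedSpace.exp (t • (-K)) (g t) = -(b t) := by
    have := congrArg (fun T : V →L[ℝ] V => T (-(b t))) hinv
    simpa [hg] using this
  convert h using 1
  rw [hinv']
  simp [neg_add_rev, add_comm]

/-- The ring of functions of time that are continuous on `I`. -/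
def continuousOnRing (I : Set ℝ) : Subalgebra ℝ (ℝ → ℝ) where
  carrier := {c | ContinuousOn c I}
  mul_mem' ha hb := ContinuousOn.mul ha hb
  add_mem' ha hb := ContinuousOn.add ha hb
  algebraMap_mem' _ := continuousOn_const

/-- Evaluation of a coefficient at a time. -/
def atTime (I : Set ℝ) (t : ℝ) : continuousOnRing I →+* ℝ :=
  (Pi.evalRingHom (fun _ : ℝ => ℝ) t).comp (continuousOnRing I).val.toRingHom

@[simp]
lemma atTime_apply {I : Set ℝ} (t : ℝ) (c : continuousOnRing I) : atTime I t c = c.1 t := rfl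

lemma map_atTime_matrix {σ : Type*} {I : Set ℝ} (L : Matrix σ σ ℝ) (t : ℝ) :
    (L.map (algebraMap ℝ (continuousOnRing I))).map (atTime I t) = L := by
  ext i j
  rfl

section Homogeneous

variable {σ : Type*} [Fintype σ]

/-- The monomials of degree `k`. -/
def monomialsOfDegree (σ : Type*) [Fintype σ] (k : ℕ) : Finset (σ →₀ ℕ) :=
  (Finsupp.finite_of_degree_eq k).toFinset

lemma mem_monomialsOfDegree {k : ℕ} {e : σ →₀ ℕ} :
    e ∈ monomialsOfDegree σ k ↔ e.degree = k := by
  simp [monomialsOfDegree]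

/-- The tuple of homogeneous polynomials with the given coefficients. -/
def ofCoeffs {R : Type*} [CommRing R] (k : ℕ) :
    (σ × monomialsOfDegree σ k → R) →ₗ[R] (σ → MvPolynomial σ R) where
  toFun c i := ∑ e : monomialsOfDegree σ k, monomial e.1 (c (i, e))
  map_add' c d := by
    funext i
    simp [Finset.sum_add_distrib]
  map_smul' a c := by
    funext i
    simp [Finset.smul_sum, smul_monomial]

variable {R : Type*} [CommRing R] {k : ℕ}

lemma ofCoeffs_apply (c : σ × monomialsOfDegree σ k → R) (i : σ) :
    ofCoeffs k c i = ∑ e : monomialsOfDegree σ k, monomial e.1 (c (i, e)) := rfl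

lemma coeff_ofCoeffs_of_mem (c : σ × monomialsOfDegree σ k → R) (i : σ) {e : σ →₀ ℕ}
    (he : e ∈ monomialsOfDegree σ k) : coeff e (ofCoeffs k c i) = c (i, ⟨e, he⟩) := by
  classical
  rw [ofCoeffs_apply, coeff_sum, Finset.sum_eq_single ⟨e, he⟩]
  · simp
  · intro d _ hd
    rw [coeff_monomial, if_neg fun h => hd (Subtype.ext h)]
  · simp

lemma coeff_ofCoeffs_of_notMem (c : σ × monomialsOfDegree σ k → R) (i : σ) {e : σ →₀ ℕ}
    (he : e ∉ monomialsOfDegree σ k) : coeff e (ofCoeffs k c i) = 0 := by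
  classical
  rw [ofCoeffs_apply, coeff_sum]
  refine Finset.sum_eq_zero fun d _ => ?_
  rw [coeff_monomial, if_neg]
  rintro rfl
  exact he d.2

lemma ofCoeffs_mem (c : σ × monomialsOfDegree σ k → R) (i : σ) :
    ofCoeffs k c i ∈ idealOfVars σ R ^ k := by
  rw [mem_pow_idealOfVars_iff']
  intro e he
  refine coeff_ofCoeffs_of_notMem c i fun h => ?_
  rw [mem_monomialsOfDegree] at h
  omega

lemma map_ofCoeffs {S : Type*} [CommRing S] (ρ : R →+* S) (c : σ × monomialsOfDegree σ k → R)
    (i : σ) : map ρ (ofCoeffs k c i) = ofCoeffs k (fun q => ρ (c q)) i := by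
  simp [ofCoeffs_apply, map_sum]

end Homogeneous

section NormalFormSeries

variable {σ : Type*} [Fintype σ] {I : Set ℝ}

/-- A formal conjugacy of `U' = L U + ν(t,U)` with `u' = L u + f(t,u)` by `u = φ(t,U)`, up to terms
of order `k`; only the monomials singled out by `ret` occur in `ν`. -/
structure FormalConjugacy (L : Matrix σ σ ℝ) (f : σ → MvPolynomial σ (continuousOnRing I))
    (ret : σ → (σ →₀ ℕ) → Prop) (k : ℕ)
    (φ φ' ν : σ → MvPolynomial σ (continuousOnRing I)) : Prop where
  time_deriv : ∀ i e, ∀ t ∈ I, HasDerivAt (coeff e (φ i)).1 ((coeff e (φ' i)).1 t) t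
  near_identity : ∀ i, φ i - X i ∈ idealOfVars σ _ ^ 2
  order_two : ∀ i, ν i ∈ idealOfVars σ _ ^ 2
  retained : ∀ i e, ¬ ret i e → coeff e (ν i) = 0
  order_residual : ∀ t ∈ I, ∀ i,
    map (atTime I t) (conjResidual (L.map (algebraMap ℝ _)) f φ φ' ν i) ∈ idealOfVars σ ℝ ^ k

lemma FormalConjugacy.trivial (L : Matrix σ σ ℝ)
    {f : σ → MvPolynomial σ (continuousOnRing I)} (hf : ∀ i, f i ∈ idealOfVars σ _ ^ 2)
    (ret : σ → (σ →₀ ℕ) → Prop) : FormalConjugacy L f ret 2 X 0 0 where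
  time_deriv i e t _ := by
    classical
    have : (coeff e (X i : MvPolynomial σ (continuousOnRing I))).1 =
        fun _ => if Finsupp.single i 1 = e then 1 else 0 := by
      rw [coeff_X]
      split_ifs <;> rfl
    rw [this]
    exact hasDerivAt_const _ _
  near_identity i := by simp
  order_two i := zero_mem _
  retained i e _ := by simp
  order_residual t _ i := by
    classical
    refine map_mem_pow_idealOfVars _ ?_
    have : conjResidual (L.map (algebraMap ℝ (continuousOnRing I))) f X 0 0 i = - f i := by
      simp [conjResidual, pderiv_X, Pi.single_apply, linearField]
    rw [this]
    exact neg_mem (hf i)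

theorem FormalConjugacy.exists_succ (hI : IsOpen I) (hI' : I.OrdConnected) (hne : I.Nonempty)
    {L : Matrix σ σ ℝ} {f : σ → MvPolynomial σ (continuousOnRing I)}
    (hf : ∀ i, f i ∈ idealOfVars σ _ ^ 2) {ret : σ → (σ →₀ ℕ) → Prop} {k : ℕ} (hk : 2 ≤ k)
    {φ φ' ν : σ → MvPolynomial σ (continuousOnRing I)} (h : FormalConjugacy L f ret k φ φ' ν) :
    ∃ φ₁ φ₁' ν₁, FormalConjugacy L f ret (k + 1) φ₁ φ₁' ν₁ := by
  classical
  set L' := L.map (algebraMap ℝ (continuousOnRing I)) with hL'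
  set r := conjResidual L' f φ φ' ν with hr
  let K : (σ × monomialsOfDegree σ k → ℝ) →ₗ[ℝ] (σ × monomialsOfDegree σ k → ℝ) :=
    { toFun := fun c q => if ret q.1 q.2 then 0 else coeff q.2.1 (homological L (ofCoeffs k c) q.1)
      map_add' := fun c d => by
        funext q
        by_cases hq : ret q.1 q.2 <;> simp [hq]
      map_smul' := fun a c => by
        funext q
        by_cases hq : ret q.1 q.2 <;> simp [hq] }
  let b : ℝ → σ × monomialsOfDegree σ k → ℝ := fun t q => if ret q.1 q.2 then 0 else (coeff q.2.1 (r q.1)).1 t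
  have hb : ContinuousOn b I := by
    refine continuousOn_pi.2 fun q => ?_
    simp only [b]
    split_ifs
    · exact continuousOn_const
    · exact (coeff q.2.1 (r q.1)).2
  obtain ⟨c, hc⟩ := exists_hasDerivAt_linear K.toContinuousLinearMap hI hI' hne hb
  have hcc : ContinuousOn c I := fun t ht => (hc t ht).continuousAt.continuousWithinAt
  let c₀ : σ × monomialsOfDegree σ k → continuousOnRing I := fun q =>
    ⟨fun t => c t q, (continuous_apply q).comp_continuousOn hcc⟩
  let c₁ : σ × monomialsOfDegree σ k → continuousOnRing I := fun q =>
    ⟨fun t => -(K (c t) q + b t q),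
      ((continuous_apply q).comp_continuousOn
        ((K.toContinuousLinearMap.continuous.comp_continuousOn hcc).add hb)).neg⟩
  set η := ofCoeffs k c₀ with hη
  set η' := ofCoeffs k c₁ with hη'
  let z : σ × monomialsOfDegree σ k → continuousOnRing I := fun q =>
    if ret q.1 q.2 then -(coeff q.2.1 (r q.1) + coeff q.2.1 (homological L' η q.1)) else 0
  set ζ := ofCoeffs k z with hζ
  have hηm : ∀ i, η i ∈ idealOfVars σ _ ^ k := ofCoeffs_mem c₀
  have hζm : ∀ i, ζ i ∈ idealOfVars σ _ ^ k := ofCoeffs_mem z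
  have hle := Ideal.pow_le_pow_right (I := idealOfVars σ (continuousOnRing I)) hk
  refine ⟨φ + η, φ' + η', ν + ζ, ⟨?_, ?_, ?_, ?_, ?_⟩⟩
  · intro i e t ht
    have h1 := h.time_deriv i e t ht
    simp only [Pi.add_apply, coeff_add]
    by_cases he : e ∈ monomialsOfDegree σ k
    · rw [hη, hη', coeff_ofCoeffs_of_mem _ _ he, coeff_ofCoeffs_of_mem _ _ he]
      exact h1.add (hasDerivAt_pi.1 (hc t ht) (i, ⟨e, he⟩))
    · rw [hη, hη', coeff_ofCoeffs_of_notMem _ _ he, coeff_ofCoeffs_of_notMem _ _ he]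
      simpa using h1
  · intro i
    have : (φ + η) i - X i = (φ i - X i) + η i := by
      rw [Pi.add_apply]
      ring
    rw [this]
    exact add_mem (h.near_identity i) (hle (hηm i))
  · exact fun i => add_mem (h.order_two i) (hle (hζm i))
  · intro i e he
    rw [Pi.add_apply, coeff_add, h.retained i e he, zero_add]
    by_cases hek : e ∈ monomialsOfDegree σ k
    · rw [hζ, coeff_ofCoeffs_of_mem _ _ hek]
      simp [z, he]
    · exact coeff_ofCoeffs_of_notMem _ _ hek
  · intro t ht i
    have key := map_mem_pow_idealOfVars (atTime I t)
      (conjResidual_add_mem hk L' (φ' := φ') (η' := η') hf h.near_identity h.order_two hηm hζm i)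
    rw [map_sub] at key
    refine (Submodule.sub_mem_iff_left _ ?_).1 key
    rw [mem_pow_idealOfVars_iff']
    intro e he
    rcases Nat.lt_succ_iff_lt_or_eq.1 he with he | he
    · refine (mem_pow_idealOfVars_iff' k _).1 ?_ e he
      rw [map_add]
      refine add_mem (h.order_residual t ht i) (map_mem_pow_idealOfVars _ ?_)
      refine add_mem (add_mem (ofCoeffs_mem c₁ i) ?_) (hζm i)
      obtain ⟨j, rfl⟩ : ∃ j, k = j + 1 := ⟨k - 1, by omega⟩
      exact homological_mem L' hηm i
    · have hek : e ∈ monomialsOfDegree σ k := mem_monomialsOfDegree.2 he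
      have hhom : atTime I t (coeff e (homological L' η i)) =
          coeff e (homological L (ofCoeffs k (c t)) i) := by
        rw [← coeff_map, map_homological, map_atTime_matrix]
        simp_rw [hη, map_ofCoeffs]
        rfl
      rw [coeff_map]
      simp only [coeff_add, map_add, hη', hζ, coeff_ofCoeffs_of_mem _ _ hek]
      rw [hhom]
      by_cases hret : ret i e
      · simp only [z, hret, if_true, map_neg, map_add, hhom]
        simp [c₁, K, b, hret]
        ring
      · simp only [z, hret, if_false, map_zero]
        simp [c₁, K, b, hret, hr]

theorem exists_formalConjugacy (hI : IsOpen I) (hI' : I.OrdConnected) (hne : I.Nonempty)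
    (L : Matrix σ σ ℝ) {f : σ → MvPolynomial σ (continuousOnRing I)}
    (hf : ∀ i, f i ∈ idealOfVars σ _ ^ 2) (ret : σ → (σ →₀ ℕ) → Prop) {k : ℕ} (hk : 2 ≤ k) :
    ∃ φ φ' ν, FormalConjugacy L f ret k φ φ' ν := by
  induction k, hk using Nat.le_induction with
  | base => exact ⟨X, 0, 0, .trivial L hf ret⟩
  | succ k hk ih =>
    obtain ⟨φ, φ', ν, h⟩ := ih
    exact h.exists_succ hI hI' hne hf hk

end NormalFormSeries

section PolynomialFunctions

variable {σ : Type*} [Fintype σ] {I : Set ℝ}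

/-- The function of time and state defined by a polynomial with time dependent coefficients. -/
def polyAt (q : MvPolynomial σ (continuousOnRing I)) (t : ℝ) (x : σ → ℝ) : ℝ :=
  eval x (map (atTime I t) q)

lemma polyAt_eq_sum {q : MvPolynomial σ (continuousOnRing I)} {s : Finset (σ →₀ ℕ)}
    (hs : q.support ⊆ s) (t : ℝ) (x : σ → ℝ) :
    polyAt q t x = ∑ e ∈ s, (coeff e q).1 t * ∏ i, x i ^ e i := by
  rw [polyAt, eval_map, eval₂_eq', Finset.sum_subset hs]
  · rfl
  · intro e _ he
    rw [notMem_support_iff.1 he, map_zero, zero_mul]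

lemma contDiffOn_one_of_hasDerivAt (hI : IsOpen I) {c c' : ℝ → ℝ} (hc' : ContinuousOn c' I)
    (h : ∀ t ∈ I, HasDerivAt c (c' t) t) : ContDiffOn ℝ 1 c I := by
  have := (contDiffOn_succ_iff_deriv_of_isOpen (n := 0) (𝕜 := ℝ) (f := c) hI).2
    ⟨fun t ht => (h t ht).differentiableAt.differentiableWithinAt, by simp,
      contDiffOn_zero.2 (hc'.congr fun t ht => (h t ht).deriv)⟩
  simpa using this

lemma contDiff_polyAt (q : MvPolynomial σ (continuousOnRing I)) (t : ℝ) {k : WithTop ℕ∞} :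
    ContDiff ℝ k (polyAt q t) := by
  have : polyAt q t = fun x => ∑ e ∈ q.support, (coeff e q).1 t * ∏ i, x i ^ e i :=
    funext fun x => polyAt_eq_sum subset_rfl t x
  rw [this]
  fun_prop

lemma contDiffOn_uncurry_polyAt {q : MvPolynomial σ (continuousOnRing I)} {k : WithTop ℕ∞}
    (hq : ∀ e, ContDiffOn ℝ k (coeff e q).1 I) :
    ContDiffOn ℝ k (fun z : ℝ × (σ → ℝ) => polyAt q z.1 z.2) (I ×ˢ univ) := by
  simp_rw [polyAt_eq_sum subset_rfl]
  refine ContDiffOn.sum fun e _ => ContDiffOn.mul ?_ ?_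
  · exact (hq e).comp contDiffOn_fst fun z hz => hz.1
  · exact ContDiff.contDiffOn (by fun_prop)

lemma hasFDerivAt_eval (q : MvPolynomial σ ℝ) (x : σ → ℝ) :
    HasFDerivAt (fun y => eval y q)
      (∑ j, eval x (pderiv j q) • ContinuousLinearMap.proj (R := ℝ) (φ := fun _ : σ => ℝ) j) x := by
  classical
  induction q using MvPolynomial.induction_on with
  | C a => simpa using hasFDerivAt_const a x
  | add p q hp hq =>
    simp only [map_add, add_smul, Finset.sum_add_distrib]
    exact hp.add hq
  | mul_X p i hp =>
    have h := hp.mul (ContinuousLinearMap.proj (R := ℝ) (φ := fun _ : σ => ℝ) i).hasFDerivAt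
      (x := x)
    simp only [map_mul, eval_X]
    refine h.congr_fderiv ?_
    ext v
    simp only [Derivation.leibniz, pderiv_X, Pi.single_apply, smul_eq_mul, map_add, map_mul,
      eval_X, apply_ite (eval x), map_zero, mul_ite, mul_one, mul_zero,
      _root_.add_apply, _root_.smul_apply, _root_.sum_apply,
      ContinuousLinearMap.proj_apply, add_mul, ite_mul, zero_mul, Finset.sum_add_distrib,
      Finset.sum_ite_eq, Finset.mem_univ, if_true, Finset.mul_sum, mul_assoc]

lemma hasDerivAt_polyAt {q q' : MvPolynomial σ (continuousOnRing I)} {t : ℝ}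
    (h : ∀ e, HasDerivAt (coeff e q).1 ((coeff e q').1 t) t) (x : σ → ℝ) :
    HasDerivAt (fun s => polyAt q s x) (polyAt q' t x) t := by
  classical
  have h1 : q.support ⊆ q.support ∪ q'.support := Finset.subset_union_left
  have h2 : q'.support ⊆ q.support ∪ q'.support := Finset.subset_union_right
  simp_rw [polyAt_eq_sum h1, polyAt_eq_sum h2]
  exact HasDerivAt.fun_sum fun e _ => (h e).mul_const _

/-- A polynomial whose monomials have degree at least `k` is bounded by `c ‖x‖ ^ k` for small `x`,
uniformly over compact time intervals. -/
lemma exists_abs_polyAt_le {q : MvPolynomial σ (continuousOnRing I)} {k : ℕ}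
    (hq : ∀ t ∈ I, map (atTime I t) q ∈ idealOfVars σ ℝ ^ k) {a b : ℝ} (hab : Icc a b ⊆ I) :
    ∃ c : ℝ, 0 ≤ c ∧ ∀ t ∈ Icc a b, ∀ x : σ → ℝ, ‖x‖ ≤ 1 → |polyAt q t x| ≤ c * ‖x‖ ^ k := by
  have hbd : ∀ e, ∃ c : ℝ, ∀ t ∈ Icc a b, ‖(coeff e q).1 t‖ ≤ c := fun e =>
    isCompact_Icc.exists_bound_of_continuousOn (ContinuousOn.mono (coeff e q).2 hab)
  choose C hC using hbd
  refine ⟨∑ e ∈ q.support, |C e|, Finset.sum_nonneg fun _ _ => abs_nonneg _, fun t ht x hx => ?_⟩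
  rw [polyAt_eq_sum subset_rfl, Finset.sum_mul]
  refine (Finset.abs_sum_le_sum_abs _ _).trans (Finset.sum_le_sum fun e _ => ?_)
  rw [abs_mul]
  by_cases he : e.degree < k
  · have := (mem_pow_idealOfVars_iff' k _).1 (hq t (hab ht)) e he
    rw [coeff_map, atTime_apply] at this
    rw [this]
    simp only [abs_zero, zero_mul]
    positivity
  · refine mul_le_mul ((hC e t ht).trans (le_abs_self _)) ?_ (abs_nonneg _) (abs_nonneg _)
    calc |∏ i, x i ^ e i| = ∏ i, ‖x i‖ ^ e i := by simp [Finset.abs_prod, abs_pow]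
      _ ≤ ∏ i, ‖x‖ ^ e i := Finset.prod_le_prod (fun i _ => by positivity)
          fun i _ => pow_le_pow_left₀ (norm_nonneg _) (norm_le_pi_norm x i) _
      _ = ‖x‖ ^ e.degree := by
          rw [Finset.prod_pow_eq_pow_sum, Finsupp.degree_eq_sum]
      _ ≤ ‖x‖ ^ k := pow_le_pow_of_le_one (norm_nonneg _) hx (not_lt.1 he)

end PolynomialFunctions

section StateCoordinates

variable {m n l : ℕ}

/-- The coordinates of a state, as a linear equivalence. -/
def coordsEquiv (m n l : ℕ) : State m n l ≃L[ℝ] (Fin m ⊕ Fin n ⊕ Fin l → ℝ) :=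
  LinearEquiv.toContinuousLinearEquiv
    { toFun := coords
      invFun := fun x => (WithLp.toLp 2 fun i => x (.inl i), WithLp.toLp 2 fun j => x (.inr (.inl j)),
        WithLp.toLp 2 fun k => x (.inr (.inr k)))
      map_add' := fun u v => by
        funext i
        rcases i with i | i | i <;> rfl
      map_smul' := fun c u => by
        funext i
        rcases i with i | i | i <;> rfl
      left_inv := fun u => rfl
      right_inv := fun x => by
        funext i
        rcases i with i | i | i <;> rfl }

@[simp]
lemma coordsEquiv_apply (u : State m n l) : coordsEquiv m n l u = coords u := rfl

@[simp]
lemma coords_coordsEquiv_symm (x : Fin m ⊕ Fin n ⊕ Fin l → ℝ) :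
    coords ((coordsEquiv m n l).symm x) = x :=
  (coordsEquiv m n l).apply_symm_apply x

lemma norm_coords_le (u : State m n l) : ‖coords u‖ ≤ ‖u‖ := by
  refine (pi_norm_le_iff_of_nonneg (norm_nonneg _)).2 fun i => ?_
  rcases i with i | i | i
  · exact (PiLp.norm_apply_le u.1 i).trans (norm_fst_le u)
  · exact (PiLp.norm_apply_le u.2.1 i).trans ((norm_fst_le u.2).trans (norm_snd_le u))
  · exact (PiLp.norm_apply_le u.2.2 i).trans ((norm_snd_le u.2).trans (norm_snd_le u))

lemma norm_pow_le_sum (p : ℕ) (u : State m n l) :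
    ‖u‖ ^ p ≤ ‖u.1‖ ^ p + ‖u.2.1‖ ^ p + ‖u.2.2‖ ^ p := by
  have h1 : 0 ≤ ‖u.1‖ ^ p := by positivity
  have h2 : 0 ≤ ‖u.2.1‖ ^ p := by positivity
  have h3 : 0 ≤ ‖u.2.2‖ ^ p := by positivity
  rw [Prod.norm_def, Prod.norm_def]
  rcases max_choice ‖u.1‖ (max ‖u.2.1‖ ‖u.2.2‖) with h | h
  · rw [h]
    linarith
  · rw [h]
    rcases max_choice ‖u.2.1‖ ‖u.2.2‖ with h | h <;> rw [h] <;> linarith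

lemma sum_le_norm_pow (p : ℕ) (u : State m n l) :
    ‖u.1‖ ^ p + ‖u.2.1‖ ^ p + ‖u.2.2‖ ^ p ≤ 3 * ‖u‖ ^ p := by
  have h1 := pow_le_pow_left₀ (norm_nonneg u.1) (norm_fst_le u) p
  have h2 := pow_le_pow_left₀ (norm_nonneg u.2.1) ((norm_fst_le u.2).trans (norm_snd_le u)) p
  have h3 := pow_le_pow_left₀ (norm_nonneg u.2.2) ((norm_snd_le u.2).trans (norm_snd_le u)) p
  linarith

variable {W W' : Type*} [NormedAddCommGroup W] [NormedAddCommGroup W'] {p : ℕ} {I : Set ℝ}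

lemma isOrder_iff {w : ℝ → State m n l → W} :
    IsOrder p I w ↔ ∀ a b : ℝ, Icc a b ⊆ I → ∃ c r : ℝ, 0 ≤ c ∧ 0 < r ∧ ∀ t ∈ Icc a b,
      ∀ u : State m n l, ‖u‖ < r → ‖w t u‖ ≤ c * ‖u‖ ^ p := by
  refine forall₂_congr fun a b => imp_congr_right fun _ => ⟨?_, ?_⟩
  · rintro ⟨c, r, hr, h⟩
    refine ⟨|c| * 3, r, by positivity, hr, fun t ht u hu => (h t ht u hu).trans ?_⟩
    rw [mul_assoc]
    exact mul_le_mul (le_abs_self c) (sum_le_norm_pow p u) (by positivity) (abs_nonneg c)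
  · rintro ⟨c, r, hc, hr, h⟩
    exact ⟨c, r, hr, fun t ht u hu => (h t ht u hu).trans
      (mul_le_mul_of_nonneg_left (norm_pow_le_sum p u) hc)⟩

lemma IsOrder.add {w w' : ℝ → State m n l → W} (h : IsOrder p I w) (h' : IsOrder p I w') :
    IsOrder p I fun t u => w t u + w' t u := by
  rw [isOrder_iff] at *
  intro a b hab
  obtain ⟨c, r, hc, hr, h⟩ := h a b hab
  obtain ⟨c', r', hc', hr', h'⟩ := h' a b hab
  refine ⟨c + c', min r r', by positivity, lt_min hr hr', fun t ht u hu => ?_⟩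
  rw [add_mul]
  exact (norm_add_le _ _).trans
    (add_le_add (h t ht u (hu.trans_le (min_le_left _ _)))
      (h' t ht u (hu.trans_le (min_le_right _ _))))

lemma IsOrder.clm [NormedSpace ℝ W] [NormedSpace ℝ W'] {w : ℝ → State m n l → W} (h : IsOrder p I w) (T : W →L[ℝ] W') :
    IsOrder p I fun t u => T (w t u) := by
  rw [isOrder_iff] at *
  intro a b hab
  obtain ⟨c, r, hc, hr, h⟩ := h a b hab
  refine ⟨‖T‖ * c, r, by positivity, hr, fun t ht u hu => ?_⟩
  rw [mul_assoc]
  exact (T.le_opNorm _).trans (mul_le_mul_of_nonneg_left (h t ht u hu) (norm_nonneg T))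

lemma IsOrder.congr {w w' : ℝ → State m n l → W} (h : IsOrder p I w)
    (hw : ∀ t ∈ I, ∀ u, w' t u = w t u) : IsOrder p I w' := by
  intro a b hab
  obtain ⟨c, r, hr, h⟩ := h a b hab
  exact ⟨c, r, hr, fun t ht u hu => by rw [hw t (hab ht)]; exact h t ht u hu⟩

lemma isOrder_pi {ι : Type*} [Fintype ι] {w : ℝ → State m n l → ι → ℝ}
    (h : ∀ i, IsOrder p I fun t u => w t u i) : IsOrder p I w := by
  classical
  have key : ∀ s : Finset ι, IsOrder p I fun t u => ∑ i ∈ s, Pi.single i (w t u i) := by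
    intro s
    induction s using Finset.induction_on with
    | empty =>
      rw [isOrder_iff]
      exact fun a b _ => ⟨0, 1, le_rfl, one_pos, by simp⟩
    | insert i s his ih =>
      simp_rw [Finset.sum_insert his]
      exact IsOrder.add ((h i).clm (ContinuousLinearMap.single ℝ (fun _ : ι => ℝ) i)) ih
  exact (key Finset.univ).congr fun t _ u => (Finset.univ_sum_single (w t u)).symm

lemma isOrder_polyAt {q : MvPolynomial (Fin m ⊕ Fin n ⊕ Fin l) (continuousOnRing I)}
    (hq : ∀ t ∈ I, map (atTime I t) q ∈ idealOfVars _ ℝ ^ p) :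
    IsOrder p I fun t (u : State m n l) => polyAt q t (coords u) := by
  rw [isOrder_iff]
  intro a b hab
  obtain ⟨c, hc, h⟩ := exists_abs_polyAt_le hq hab
  refine ⟨c, 1, hc, one_pos, fun t ht u hu => ?_⟩
  refine (h t ht _ ((norm_coords_le u).trans hu.le)).trans ?_
  exact mul_le_mul_of_nonneg_left (pow_le_pow_left₀ (norm_nonneg _) (norm_coords_le u) p) hc

lemma isMultinomial_polyAt {q : MvPolynomial (Fin m ⊕ Fin n ⊕ Fin l) (continuousOnRing I)} {k : ℕ}
    (hq : ∀ e, ContDiffOn ℝ k (coeff e q).1 I) :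
    IsMultinomial k I fun t (u : State m n l) => polyAt q t (coords u) := by
  classical
  refine ⟨q.support.map ⟨fun e : Fin m ⊕ Fin n ⊕ Fin l →₀ ℕ => ⇑e, DFunLike.coe_injective⟩,
    fun e => (coeff (Finsupp.equivFunOnFinite.symm e) q).1, fun e _ => hq _, fun t _ u => ?_⟩
  beta_reduce
  rw [polyAt_eq_sum subset_rfl, Finset.sum_map]
  refine Finset.sum_congr rfl fun e _ => ?_
  have : Finsupp.equivFunOnFinite.symm (⇑e) = e := Finsupp.equivFunOnFinite.symm_apply_apply e
  simp [this]

lemma isMultinomial_zero_polyAt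
    (q : MvPolynomial (Fin m ⊕ Fin n ⊕ Fin l) (continuousOnRing I)) :
    IsMultinomial 0 I fun t (u : State m n l) => polyAt q t (coords u) :=
  isMultinomial_polyAt fun e => contDiffOn_zero.2 (coeff e q).2

end StateCoordinates

section TaylorPolynomial

variable {m n l : ℕ} {I : Set ℝ} {d : Set (State m n l)}

lemma IsClassC.clm {W W' : Type*} [NormedAddCommGroup W] [NormedSpace ℝ W] [NormedAddCommGroup W']
    [NormedSpace ℝ W'] (hd : IsOpen d) {k : ℕ} {w : ℝ → State m n l → W} (h : IsClassC k I d w)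
    (T : W →L[ℝ] W') : IsClassC k I d fun t u => T (w t u) := by
  refine ⟨fun t ht => T.contDiff.comp_contDiffOn (h.1 t ht), fun j hj => ?_⟩
  have hc := (ContinuousLinearMap.compContinuousMultilinearMapL ℝ
    (fun _ : Fin j => State m n l) W W' T).continuous.comp_continuousOn (h.2 j hj)
  refine hc.congr fun z hz => ?_
  exact T.iteratedFDeriv_comp_left ((h.1 z.1 hz.1).contDiffAt (hd.mem_nhds hz.2))
    (by exact_mod_cast hj)

/-- The basis of the state space dual to its coordinates. -/
def stateBasis (i : Fin m ⊕ Fin n ⊕ Fin l) : State m n l :=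
  (coordsEquiv m n l).symm (Pi.single i 1)

lemma sum_coords_smul_stateBasis (u : State m n l) : ∑ i, coords u i • stateBasis i = u := by
  apply (coordsEquiv m n l).injective
  simp only [stateBasis, map_sum, map_smul, ContinuousLinearEquiv.apply_symm_apply]
  funext i
  simp [Finset.sum_apply, Pi.single_apply]

lemma map_const_eq_sum {k : ℕ}
    (M : ContinuousMultilinearMap ℝ (fun _ : Fin k => State m n l) ℝ) (u : State m n l) :
    M (fun _ => u) = ∑ ι : Fin k → Fin m ⊕ Fin n ⊕ Fin l,
      M (fun j => stateBasis (ι j)) * ∏ j, coords u (ι j) := by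
  conv_lhs => rw [← sum_coords_smul_stateBasis u]
  rw [ContinuousMultilinearMap.map_sum]
  refine Finset.sum_congr rfl fun ι _ => ?_
  rw [ContinuousMultilinearMap.map_smul_univ, smul_eq_mul, mul_comm]

lemma IsOrder.apply_zero {W : Type*} [NormedAddCommGroup W] {w : ℝ → State m n l → W} (h : IsOrder 2 I w) {t : ℝ} (ht : t ∈ I) :
    w t 0 = 0 := by
  obtain ⟨c, r, -, hr, h⟩ := isOrder_iff.1 h t t (by simpa using ht)
  simpa using h t (by simp) 0 (by simpa using hr)

lemma IsOrder.hasFDerivAt_zero {W : Type*} [NormedAddCommGroup W] [NormedSpace ℝ W]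
    {w : ℝ → State m n l → W} (h : IsOrder 2 I w) {t : ℝ} (ht : t ∈ I) :
    HasFDerivAt (w t) (0 : State m n l →L[ℝ] W) 0 := by
  obtain ⟨c, r, hc, hr, h⟩ := isOrder_iff.1 h t t (by simpa using ht)
  have h0 : w t 0 = 0 := by simpa using h t (by simp) 0 (by simpa using hr)
  rw [hasFDerivAt_iff_isLittleO_nhds_zero]
  simp only [zero_add, h0, sub_zero, zero_apply]
  have hO : w t =O[nhds 0] fun u : State m n l => ‖u‖ ^ 2 := by
    refine Asymptotics.IsBigO.of_bound c ?_
    filter_upwards [Metric.ball_mem_nhds 0 hr] with u hu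
    simpa using h t (by simp) u (by simpa using hu)
  exact hO.trans_isLittleO (Asymptotics.isLittleO_norm_pow_id one_lt_two)

/-- The Taylor polynomial of a time dependent function of second order: up to terms of order `p`, the
function is a multinomial with coefficients that are continuous in time. -/
theorem exists_taylor_polynomial {P p : ℕ} (hp : 2 ≤ p) (hpP : p ≤ P) (hd : IsOpen d)
    (h0 : (0 : State m n l) ∈ d) {w : ℝ → State m n l → ℝ} (hw : IsClassC P I d w)
    (hw2 : IsOrder 2 I w) :
    ∃ q : MvPolynomial (Fin m ⊕ Fin n ⊕ Fin l) (continuousOnRing I), q ∈ idealOfVars _ _ ^ 2 ∧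
      IsOrder p I fun t u => w t u - polyAt q t (coords u) := by
  obtain ⟨N, rfl⟩ : ∃ N, p = N + 1 := ⟨p - 1, by omega⟩
  have hcont : ∀ k ≤ P, ContinuousOn (fun t => iteratedFDeriv ℝ k (w t) 0) I := fun k hk =>
    (hw.2 k hk).comp (f := fun t : ℝ => (t, (0 : State m n l))) (by fun_prop) fun t ht => ⟨ht, h0⟩
  let c : (k : ℕ) → (Fin k → Fin m ⊕ Fin n ⊕ Fin l) → continuousOnRing I := fun k ι =>
    if hk : k ≤ P then
      ⟨fun t => (k.factorial : ℝ)⁻¹ * iteratedFDeriv ℝ k (w t) 0 fun j => stateBasis (ι j),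
        continuousOn_const.mul
          ((ContinuousMultilinearMap.apply ℝ (fun _ : Fin k => State m n l) ℝ
            fun j => stateBasis (ι j)).continuous.comp_continuousOn (hcont k hk))⟩
    else 0
  refine ⟨∑ k ∈ Finset.Ico 2 (N + 1), ∑ ι : Fin k → Fin m ⊕ Fin n ⊕ Fin l,
    C (c k ι) * ∏ j, X (ι j), ?_, ?_⟩
  · refine Ideal.sum_mem _ fun k hk => Ideal.sum_mem _ fun ι _ => Ideal.mul_mem_left _ _ ?_
    have : ∏ j : Fin k, (X (ι j) : MvPolynomial _ (continuousOnRing I)) ∈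
        ∏ _j : Fin k, idealOfVars (Fin m ⊕ Fin n ⊕ Fin l) (continuousOnRing I) :=
      Ideal.prod_mem_prod fun j _ => Ideal.subset_span ⟨ι j, rfl⟩
    rw [Finset.prod_const, Finset.card_univ, Fintype.card_fin] at this
    exact Ideal.pow_le_pow_right (Finset.mem_Ico.1 hk).1 this
  · have hpoly : ∀ t (u : State m n l), polyAt (∑ k ∈ Finset.Ico 2 (N + 1),
        ∑ ι : Fin k → Fin m ⊕ Fin n ⊕ Fin l, C (c k ι) * ∏ j, X (ι j)) t (coords u) =
        ∑ k ∈ Finset.Ico 2 (N + 1),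
          (k.factorial : ℝ)⁻¹ • iteratedFDeriv ℝ k (w t) 0 fun _ => u := by
      intro t u
      simp only [polyAt, map_sum, map_mul, map_prod, map_C, map_X, eval_C, eval_X, atTime_apply]
      refine Finset.sum_congr rfl fun k hk => ?_
      have hk' : k ≤ P := by
        have := (Finset.mem_Ico.1 hk).2
        omega
      rw [map_const_eq_sum, Finset.smul_sum]
      refine Finset.sum_congr rfl fun ι _ => ?_
      simp only [c, dif_pos hk', smul_eq_mul, mul_assoc]
    rw [isOrder_iff]
    intro a b hab
    obtain ⟨r, hr, hrd⟩ := Metric.isOpen_iff.1 hd 0 h0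
    have hK : Icc a b ×ˢ Metric.closedBall (0 : State m n l) (r / 2) ⊆ I ×ˢ d :=
      prod_mono hab ((Metric.closedBall_subset_ball (by linarith)).trans hrd)
    have hcK := (hw.2 (N + 1) hpP).mono hK
    have hcomp : IsCompact (Icc a b ×ˢ Metric.closedBall (0 : State m n l) (r / 2)) :=
      isCompact_Icc.prod (isCompact_closedBall _ _)
    obtain ⟨M, hM⟩ := hcomp.bddAbove_image hcK.norm
    refine ⟨((N.factorial : ℝ)⁻¹ * |M|), r / 2, by positivity, by positivity, fun t ht u hu => ?_⟩
    have hball : ∀ s ∈ Icc (0 : ℝ) 1, (0 : State m n l) + s • u ∈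
        Metric.closedBall (0 : State m n l) (r / 2) := by
      intro s hs
      rw [zero_add, mem_closedBall_zero_iff, norm_smul, Real.norm_of_nonneg hs.1]
      nlinarith [hs.2, norm_nonneg u]
    have hCD : ∀ s ∈ Icc (0 : ℝ) 1, ContDiffAt ℝ (N + 1) (w t) (0 + s • u) := fun s hs => by
      have hmem : (0 : State m n l) + s • u ∈ d := (hK (mk_mem_prod ht (hball s hs))).2
      exact ((hw.1 t (hab ht)).contDiffAt (hd.mem_nhds hmem)).of_le (by exact_mod_cast hpP)
    have hT := map_add_eq_sum_add_integral_iteratedFDeriv hCD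
    rw [zero_add, Finset.range_eq_Ico, ← Finset.sum_Ico_consecutive _ (Nat.zero_le 2)
      (by omega : 2 ≤ N + 1)] at hT
    have hlow : ∑ k ∈ Finset.Ico 0 2,
        (k.factorial : ℝ)⁻¹ • (iteratedFDeriv ℝ k (w t) 0 fun _ => u) = 0 := by
      rw [← Finset.range_eq_Ico, Finset.sum_range_succ, Finset.sum_range_one]
      rw [iteratedFDeriv_zero_apply, iteratedFDeriv_one_apply, hw2.apply_zero (hab ht),
        (hw2.hasFDerivAt_zero (hab ht)).fderiv]
      simp
    rw [hpoly, hT, hlow, zero_add, add_sub_cancel_left, norm_smul, norm_inv, Real.norm_natCast,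
      mul_assoc]
    refine mul_le_mul_of_nonneg_left ?_ (by positivity)
    have hb := intervalIntegral.norm_integral_le_of_norm_le_const (a := (0 : ℝ)) (b := 1)
      (C := |M| * ‖u‖ ^ (N + 1))
      (f := fun s => (1 - s) ^ N • iteratedFDeriv ℝ (N + 1) (w t) (0 + s • u) fun _ => u) ?_
    · simpa using hb
    · intro s hs
      rw [uIoc_of_le zero_le_one] at hs
      have hs' : s ∈ Icc (0 : ℝ) 1 := ⟨hs.1.le, hs.2⟩
      rw [norm_smul, norm_pow, Real.norm_of_nonneg (by linarith [hs.2])]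
      calc (1 - s) ^ N * ‖iteratedFDeriv ℝ (N + 1) (w t) (0 + s • u) fun _ => u‖
          ≤ 1 * (|M| * ‖u‖ ^ (N + 1)) := by
            refine mul_le_mul (pow_le_one₀ (by linarith [hs.2]) (by linarith [hs.1])) ?_
              (norm_nonneg _) zero_le_one
            refine (ContinuousMultilinearMap.le_opNorm _ _).trans ?_
            rw [Finset.prod_const, Finset.card_univ, Fintype.card_fin]
            refine mul_le_mul_of_nonneg_right ?_ (by positivity)
            exact (hM ⟨(t, 0 + s • u), ⟨ht, hball s hs'⟩, rfl⟩).trans (le_abs_self M)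
        _ = _ := one_mul _

end TaylorPolynomial

section NearIdentity

open Filter Topology

variable {E : Type*} [NormedAddCommGroup E] [NormedSpace ℝ E]

/-- The region around the origin, cut off at a radius, in which the derivative of `φ` is close to the
identity. -/
def nearIdentityRegion (φ : E → E) : Set E :=
  {U | ∀ V, ‖V‖ ≤ ‖U‖ → ‖fderiv ℝ φ V - ContinuousLinearMap.id ℝ E‖ ≤ 1 / 2}

lemma convex_nearIdentityRegion (φ : E → E) : Convex ℝ (nearIdentityRegion φ) := by
  intro U hU V hV a b ha hb hab W hW
  have h : ‖W‖ ≤ max ‖U‖ ‖V‖ := by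
    refine hW.trans ((norm_add_le _ _).trans ?_)
    rw [norm_smul, norm_smul, Real.norm_of_nonneg ha, Real.norm_of_nonneg hb]
    calc a * ‖U‖ + b * ‖V‖ ≤ a * max ‖U‖ ‖V‖ + b * max ‖U‖ ‖V‖ := by
          gcongr
          · exact le_max_left _ _
          · exact le_max_right _ _
      _ = max ‖U‖ ‖V‖ := by rw [← add_mul, hab, one_mul]
  rcases le_max_iff.1 h with h | h
  · exact hU W h
  · exact hV W h

variable {φ : E → E}

lemma norm_sub_sub_le_of_mem (hφ : Differentiable ℝ φ) {U V : E} (hU : U ∈ nearIdentityRegion φ)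
    (hV : V ∈ nearIdentityRegion φ) : ‖φ U - φ V - (U - V)‖ ≤ 1 / 2 * ‖U - V‖ :=
  (convex_nearIdentityRegion φ).norm_image_sub_le_of_norm_fderiv_le' (𝕜 := ℝ)
    (s := nearIdentityRegion φ) (φ := ContinuousLinearMap.id ℝ E) (fun x _ => hφ x) (fun x hx => hx x le_rfl) hV hU

lemma norm_sub_le_of_mem (hφ : Differentiable ℝ φ) {U V : E} (hU : U ∈ nearIdentityRegion φ)
    (hV : V ∈ nearIdentityRegion φ) : ‖U - V‖ ≤ 2 * ‖φ U - φ V‖ := by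
  have h1 := norm_sub_sub_le_of_mem hφ hU hV
  have h2 := norm_sub_norm_le (U - V) (φ U - φ V)
  rw [norm_sub_rev (U - V)] at h2
  linarith

lemma norm_image_sub_le_of_mem (hφ : Differentiable ℝ φ) {U V : E}
    (hU : U ∈ nearIdentityRegion φ) (hV : V ∈ nearIdentityRegion φ) :
    ‖φ U - φ V‖ ≤ 2 * ‖U - V‖ := by
  have h1 := norm_sub_sub_le_of_mem hφ hU hV
  have h2 := norm_sub_norm_le (φ U - φ V) (U - V)
  linarith [norm_nonneg (U - V)]

lemma injOn_nearIdentityRegion (hφ : Differentiable ℝ φ) : InjOn φ (nearIdentityRegion φ) := by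
  intro U hU V hV h
  have := norm_sub_le_of_mem hφ hU hV
  rw [h, sub_self, norm_zero, mul_zero] at this
  exact sub_eq_zero.1 (norm_le_zero_iff.1 this)

lemma approximatesLinearOn_nearIdentityRegion (hφ : Differentiable ℝ φ) :
    ApproximatesLinearOn φ (ContinuousLinearMap.id ℝ E) (nearIdentityRegion φ)
      (1 / 2 : NNReal) := by
  intro U hU V hV
  simpa using norm_sub_sub_le_of_mem hφ hU hV

variable [CompleteSpace E]

lemma exists_equiv_of_norm_sub_id_le {A : E →L[ℝ] E}
    (hA : ‖A - ContinuousLinearMap.id ℝ E‖ ≤ 1 / 2) :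
    ∃ e : E ≃L[ℝ] E, (e : E →L[ℝ] E) = A := by
  have h : ‖(1 : E →L[ℝ] E) - A‖ < 1 := by
    rw [norm_sub_rev]
    exact hA.trans_lt (by norm_num)
  refine ⟨ContinuousLinearEquiv.ofUnit (Units.oneSub _ h), ?_⟩
  change ((Units.oneSub (1 - A) h : (E →L[ℝ] E)ˣ) : E →L[ℝ] E) = A
  simp

/-- A near identity map is a diffeomorphism from a ball in the region where its derivative is close to
the identity. -/
lemma exists_inverse_of_ball_subset {k : ℕ} (hk : 1 ≤ k) (hφ : ContDiff ℝ k φ) {r : ℝ}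
    (hr : Metric.ball 0 r ⊆ nearIdentityRegion φ) :
    IsOpen (φ '' Metric.ball 0 r) ∧ ∃ ψ : E → E,
      InvOn ψ φ (Metric.ball 0 r) (φ '' Metric.ball 0 r) ∧
        ContDiffOn ℝ k ψ (φ '' Metric.ball 0 r) := by
  have hd : Differentiable ℝ φ := hφ.differentiable (by exact_mod_cast Nat.one_le_iff_ne_zero.1 hk)
  have ha : ApproximatesLinearOn φ (ContinuousLinearEquiv.refl ℝ E : E →L[ℝ] E) (Metric.ball 0 r)
      (1 / 2 : NNReal) := (approximatesLinearOn_nearIdentityRegion hd).mono_set hr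
  have hc : Subsingleton E ∨ (1 / 2 : NNReal) <
      ‖((ContinuousLinearEquiv.refl ℝ E).symm : E →L[ℝ] E)‖₊⁻¹ := by
    rcases subsingleton_or_nontrivial E with h | h
    · exact Or.inl h
    · right
      have : ‖((ContinuousLinearEquiv.refl ℝ E).symm : E →L[ℝ] E)‖₊ = 1 := by
        ext
        exact ContinuousLinearMap.norm_id
      rw [this, inv_one]
      exact NNReal.half_lt_self one_ne_zero
  set e := ha.toOpenPartialHomeomorph φ _ hc Metric.isOpen_ball with he
  have hs : e.source = Metric.ball 0 r := rfl
  have ht : e.target = φ '' Metric.ball 0 r := rfl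
  refine ⟨ht ▸ e.open_target, e.symm, ⟨?_, ?_⟩, ?_⟩
  · exact fun U hU => e.left_inv hU
  · exact fun u hu => e.right_inv (ht ▸ hu)
  · rw [← ht]
    intro u hu
    have hU : e.symm u ∈ Metric.ball 0 r := e.map_target hu
    obtain ⟨A, hA⟩ := exists_equiv_of_norm_sub_id_le (hr hU _ le_rfl)
    refine (e.contDiffAt_symm hu (f₀' := A) ?_ hφ.contDiffAt).contDiffWithinAt
    rw [hA]
    exact (hd _).hasFDerivAt

lemma closedBall_subset_image (hφ : Differentiable ℝ φ) (h0 : φ 0 = 0) {ε : ℝ} (hε : 0 ≤ ε)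
    (hr : Metric.closedBall 0 ε ⊆ nearIdentityRegion φ) :
    Metric.closedBall 0 (ε / 2) ⊆ φ '' Metric.closedBall 0 ε := by
  have ha := (approximatesLinearOn_nearIdentityRegion hφ).mono_set hr
  let g : (ContinuousLinearMap.id ℝ E).NonlinearRightInverse :=
    { toFun := id
      nnnorm := 1
      bound' := by simp
      right_inv' := by simp }
  have h := ha.surjOn_closedBall_of_nonlinearRightInverse g hε subset_rfl
  have h1 : ((g.nnnorm : ℝ)⁻¹ - ((1 / 2 : NNReal) : ℝ)) * ε = ε / 2 := by
    norm_num [g]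
    ring
  rw [h0, h1] at h
  exact h

end NearIdentity

section TimeDependentMaps

open Filter Topology

/-- A function that is small at the origin is small on a ball, uniformly over compact time intervals.
-/
lemma exists_ball_forall_lt {E : Type*} [NormedAddCommGroup E] {I : Set ℝ} (hI : IsOpen I) {g : ℝ × E → ℝ}
    (hg : ContinuousOn g (I ×ˢ univ)) {a b ε : ℝ} (hab : Icc a b ⊆ I)
    (h0 : ∀ t ∈ Icc a b, g (t, 0) < ε) :
    ∃ r > 0, ∀ t ∈ Icc a b, ∀ U : E, ‖U‖ < r → g (t, U) < ε := by
  have h : ∀ᶠ U in 𝓝 (0 : E), ∀ t ∈ Icc a b, g (t, U) < ε := by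
    refine isCompact_Icc.eventually_forall_of_forall_eventually fun t ht => ?_
    have hc : ContinuousAt g (t, 0) :=
      hg.continuousAt ((hI.prod isOpen_univ).mem_nhds ⟨hab ht, mem_univ _⟩)
    have hsw : ContinuousAt (fun z : E × ℝ => g (z.2, z.1)) (0, t) :=
      ContinuousAt.comp (g := g) (f := Prod.swap) hc continuous_swap.continuousAt
    exact hsw.eventually_lt_const (h0 t ht)
  obtain ⟨r, hr, h⟩ := Metric.eventually_nhds_iff.1 h
  exact ⟨r, hr, fun t ht U hU => h (by simpa using hU) t ht⟩

variable {E : Type*} [NormedAddCommGroup E] [NormedSpace ℝ E] {I : Set ℝ} {φ : ℝ → E → E}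

lemma fderiv_uncurry_apply (hI : IsOpen I)
    (hΦ : ContDiffOn ℝ 1 (Function.uncurry φ) (I ×ˢ univ)) {t : ℝ} (ht : t ∈ I) (U : E) (τ : ℝ)
    (V : E) : fderiv ℝ (Function.uncurry φ) (t, U) (τ, V) =
      τ • deriv (fun s => φ s U) t + fderiv ℝ (φ t) U V := by
  have hd : DifferentiableAt ℝ (Function.uncurry φ) (t, U) :=
    (hΦ.contDiffAt ((hI.prod isOpen_univ).mem_nhds ⟨ht, mem_univ _⟩)).differentiableAt one_ne_zero
  have h1 : HasDerivAt (fun s => φ s U) (fderiv ℝ (Function.uncurry φ) (t, U) (1, 0)) t :=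
    HasFDerivAt.comp_hasDerivAt (f := fun s : ℝ => (s, U)) t hd.hasFDerivAt
      ((hasDerivAt_id t).prodMk (hasDerivAt_const t U))
  have h2 : HasFDerivAt (φ t) ((fderiv ℝ (Function.uncurry φ) (t, U)).comp
      (ContinuousLinearMap.inr ℝ ℝ E)) U :=
    HasFDerivAt.comp (f := fun V : E => (t, V)) U hd.hasFDerivAt (hasFDerivAt_prodMk_right t U)
  rw [h1.deriv, h2.fderiv, ContinuousLinearMap.comp_apply, ContinuousLinearMap.inr_apply,
    ← map_smul, ← map_add]
  simp

lemma continuousOn_fderiv_slice (hI : IsOpen I)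
    (hΦ : ContDiffOn ℝ 1 (Function.uncurry φ) (I ×ˢ univ)) :
    ContinuousOn (fun z : ℝ × E => fderiv ℝ (φ z.1) z.2) (I ×ˢ univ) := by
  have hc := hΦ.continuousOn_fderiv_of_isOpen (hI.prod isOpen_univ) le_rfl
  have := hc.clm_comp (continuousOn_const (c := ContinuousLinearMap.inr ℝ ℝ E))
  refine this.congr fun z hz => ?_
  ext V
  have := fderiv_uncurry_apply hI hΦ hz.1 z.2 0 V
  simpa using this.symm

lemma exists_ball_subset_nearIdentityRegion (hI : IsOpen I)
    (hΦ : ContDiffOn ℝ 1 (Function.uncurry φ) (I ×ˢ univ))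
    (hid : ∀ t ∈ I, fderiv ℝ (φ t) 0 = ContinuousLinearMap.id ℝ E) {a b : ℝ}
    (hab : Icc a b ⊆ I) :
    ∃ r > 0, ∀ t ∈ Icc a b, Metric.ball 0 r ⊆ nearIdentityRegion (φ t) := by
  obtain ⟨r, hr, h⟩ := exists_ball_forall_lt (ε := 1 / 2) hI
    ((continuousOn_fderiv_slice hI hΦ).sub
      (continuousOn_const (c := ContinuousLinearMap.id ℝ E))).norm hab fun t ht => by
        simp [hid t (hab ht)]
  refine ⟨r, hr, fun t ht U hU V hV => (h t ht V (hV.trans_lt ?_)).le⟩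
  simpa using hU

/-- The lift of a differentiable curve by a time dependent near identity map is differentiable. -/
lemma HasDerivWithinAt.lift [CompleteSpace E] (hI : IsOpen I)
    (hΦ : ContDiffOn ℝ 1 (Function.uncurry φ) (I ×ˢ univ)) {J : Set ℝ} {r : ℝ} (hJ : J ⊆ I)
    (hr : ∀ t ∈ J, Metric.ball 0 r ⊆ nearIdentityRegion (φ t)) {w W : ℝ → E} {N : E} {t : ℝ}
    (ht : t ∈ J) (hW : ∀ s ∈ J, W s ∈ Metric.ball 0 r) (hw : ∀ s ∈ J, φ s (W s) = w s)
    (hd : HasDerivWithinAt w (deriv (fun s => φ s (W t)) t + fderiv ℝ (φ t) (W t) N) J t) :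
    HasDerivWithinAt W N J t := by
  have hmem : ∀ s ∈ I, ∀ U : E, I ×ˢ univ ∈ 𝓝 (s, U) := fun s hs U =>
    (hI.prod isOpen_univ).mem_nhds ⟨hs, mem_univ _⟩
  have hdiff : ∀ s ∈ I, Differentiable ℝ (φ s) := fun s hs U =>
    ((hΦ.contDiffAt (hmem s hs U)).differentiableAt one_ne_zero).comp
      (f := fun V : E => (s, V)) U (by fun_prop)
  have hcont : ContinuousWithinAt W J t := by
    have h1 : Tendsto (fun s => 2 * ‖w s - φ s (W t)‖) (𝓝[J] t) (𝓝 0) := by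
      have hφt : ContinuousWithinAt (fun s => φ s (W t)) J t :=
        (ContinuousAt.comp (f := fun s : ℝ => (s, W t)) (hΦ.contDiffAt
          (hmem t (hJ ht) (W t))).continuousAt (by fun_prop)).continuousWithinAt
      have := ((hd.continuousWithinAt.sub hφt).norm.const_mul 2).tendsto
      simpa [hw t ht] using this
    refine tendsto_iff_norm_sub_tendsto_zero.2 (squeeze_zero' (by simp) ?_ h1)
    filter_upwards [self_mem_nhdsWithin] with s hs
    rw [← hw s hs]
    exact norm_sub_le_of_mem (hdiff s (hJ hs)) (hr s hs (hW s hs)) (hr s hs (hW t ht))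
  have hstrict := (hΦ.contDiffAt (hmem t (hJ ht) (W t))).hasStrictFDerivAt one_ne_zero
  obtain ⟨A, hA⟩ := exists_equiv_of_norm_sub_id_le (hr t ht (hW t ht) _ le_rfl)
  let T : E := deriv (fun s => φ s (W t)) t
  let e : (ℝ × E) ≃L[ℝ] (ℝ × E) := ContinuousLinearEquiv.equivOfInverse
    ((ContinuousLinearMap.fst ℝ ℝ E).prod (fderiv ℝ (Function.uncurry φ) (t, W t)))
    ((ContinuousLinearMap.fst ℝ ℝ E).prod ((A.symm : E →L[ℝ] E).comp
      (ContinuousLinearMap.snd ℝ ℝ E - (ContinuousLinearMap.fst ℝ ℝ E).smulRight T)))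
    (fun z => by
      have h := fderiv_uncurry_apply hI hΦ (hJ ht) (W t) z.1 z.2
      refine Prod.ext rfl ?_
      simp [h, T, ← hA])
    (fun z => by
      have h := fderiv_uncurry_apply hI hΦ (hJ ht) (W t) z.1 (A.symm (z.2 - z.1 • T))
      refine Prod.ext rfl ?_
      simp only [ContinuousLinearMap.prod_apply, ContinuousLinearMap.coe_fst',
        ContinuousLinearMap.comp_apply, ContinuousLinearMap.coe_snd', sub_apply,
        ContinuousLinearMap.smulRight_apply, ContinuousLinearEquiv.coe_coe, h, ← hA,
        ContinuousLinearEquiv.apply_symm_apply, T]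
      abel)
  have hΨ : HasStrictFDerivAt (fun z : ℝ × E => (z.1, Function.uncurry φ z))
      (e : (ℝ × E) →L[ℝ] (ℝ × E)) (t, W t) := hasStrictFDerivAt_fst.prodMk hstrict
  have hcurve : HasDerivWithinAt (fun s => (s, w s)) ((1 : ℝ), T + fderiv ℝ (φ t) (W t) N) J t :=
    (hasDerivWithinAt_id t J).prodMk hd
  have hinv := hΨ.to_localInverse.hasFDerivAt
  have hpt : ((t, W t).1, Function.uncurry φ (t, W t)) = (t, w t) :=
    Prod.ext rfl (hw t ht)
  rw [hpt] at hinv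
  have hcomp := hinv.comp_hasDerivWithinAt t hcurve
  have hev : ∀ᶠ s in 𝓝[J] t, (s, W s) = hΨ.localInverse _ _ _ (s, w s) := by
    have htend : Tendsto (fun s => (s, W s)) (𝓝[J] t) (𝓝 (t, W t)) :=
      (continuousWithinAt_id.prodMk hcont).tendsto
    filter_upwards [htend.eventually hΨ.eventually_left_inverse, self_mem_nhdsWithin] with s hs hsJ
    rw [← hs]
    simp [Function.uncurry, hw s hsJ]
  have hlift : HasDerivWithinAt (fun s => (s, W s)) ((1 : ℝ), N) J t := by
    refine (hcomp.congr_of_eventuallyEq hev (hev.self_of_nhdsWithin ht)).congr_deriv ?_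
    rw [ContinuousLinearEquiv.coe_coe, ContinuousLinearEquiv.symm_apply_eq]
    refine Prod.ext rfl ?_
    have h := fderiv_uncurry_apply hI hΦ (hJ ht) (W t) 1 N
    rw [one_smul] at h
    exact h.symm
  exact hlift.snd

/-- A solution of a differential inequality that vanishes at one time vanishes at all times. -/
lemma eq_zero_of_norm_deriv_le {F : Type*} [NormedAddCommGroup F] [NormedSpace ℝ F] {J : Set ℝ}
    (hJ : J.OrdConnected) {f f' : ℝ → F} {K : ℝ} (hf : ∀ t ∈ J, HasDerivWithinAt f (f' t) J t)
    (hK : ∀ t ∈ J, ‖f' t‖ ≤ K * ‖f t‖) {t₀ : ℝ} (ht₀ : t₀ ∈ J) (h0 : f t₀ = 0) {t : ℝ}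
    (ht : t ∈ J) : f t = 0 := by
  have key : ∀ {J : Set ℝ}, J.OrdConnected → ∀ {f f' : ℝ → F},
      (∀ t ∈ J, HasDerivWithinAt f (f' t) J t) → (∀ t ∈ J, ‖f' t‖ ≤ K * ‖f t‖) →
      ∀ t₀ ∈ J, f t₀ = 0 → ∀ t ∈ J, t₀ ≤ t → f t = 0 := by
    intro J hJ f f' hf hK t₀ ht₀ h0 t ht hle
    have hsub : Icc t₀ t ⊆ J := hJ.out ht₀ ht
    refine eq_zero_of_abs_deriv_le_mul_abs_self_of_eq_zero_right (f' := f') (K := K)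
      (fun s hs => (hf s (hsub hs)).continuousWithinAt.mono hsub) (fun s hs => ?_) h0
      (fun s hs => hK s (hsub (Ico_subset_Icc_self hs))) t ⟨hle, le_rfl⟩
    refine ((hf s (hsub (Ico_subset_Icc_self hs))).mono hsub).mono_of_mem_nhdsWithin ?_
    exact Icc_mem_nhdsGE_of_mem hs
  rcases le_total t₀ t with h | h
  · exact key hJ hf hK t₀ ht₀ h0 t ht h
  · have hJ' : (Neg.neg ⁻¹' J).OrdConnected :=
      ⟨fun x hx y hy z hz => hJ.out hy hx ⟨neg_le_neg hz.2, neg_le_neg hz.1⟩⟩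
    have := key hJ' (f := fun s => f (-s)) (f' := fun s => -f' (-s)) (fun s hs => ?_)
      (fun s hs => by simpa using hK (-s) hs) (-t₀) (by simpa using ht₀) (by simpa using h0) (-t)
      (by simpa using ht) (neg_le_neg h)
    · simpa using this
    · have h1 := (hf (-s) hs).scomp s (hasDerivWithinAt_neg s (Neg.neg ⁻¹' J)) fun x hx => hx
      simpa [Function.comp_def] using h1

end TimeDependentMaps

section PolyAtAlgebra

variable {σ : Type*} {I : Set ℝ} (t : ℝ) (x : σ → ℝ)

lemma polyAt_bind₁ (φ : σ → MvPolynomial σ (continuousOnRing I))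
    (q : MvPolynomial σ (continuousOnRing I)) :
    polyAt (bind₁ φ q) t x = polyAt q t fun i => polyAt (φ i) t x := by
  simp only [polyAt, map_bind₁]
  induction map (atTime I t) q using MvPolynomial.induction_on with
  | C a => simp
  | add p q hp hq => simp [hp, hq]
  | mul_X p i hp => simp [hp]

lemma polyAt_linearField [Fintype σ] (L : Matrix σ σ ℝ) (i : σ) :
    polyAt (linearField (L.map (algebraMap ℝ (continuousOnRing I))) i) t x =
      ∑ j, L i j * x j := by
  simp only [polyAt, map_linearField, map_atTime_matrix]
  simp [linearField]

lemma polyAt_add (p q : MvPolynomial σ (continuousOnRing I)) :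
    polyAt (p + q) t x = polyAt p t x + polyAt q t x := by
  simp [polyAt]

lemma polyAt_conjResidual [Fintype σ] (L : Matrix σ σ ℝ)
    (f φ φ' ν : σ → MvPolynomial σ (continuousOnRing I)) (i : σ) :
    polyAt (conjResidual (L.map (algebraMap ℝ (continuousOnRing I))) f φ φ' ν i) t x =
      polyAt (φ' i) t x + ∑ j, eval x (pderiv j (map (atTime I t) (φ i))) *
        polyAt (linearField (L.map (algebraMap ℝ (continuousOnRing I))) j + ν j) t x -
      ∑ j, L i j * polyAt (φ j) t x - polyAt (f i) t fun i => polyAt (φ i) t x := by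
  rw [← polyAt_bind₁]
  simp only [polyAt, conjResidual, map_sub, map_add, map_sum, map_mul, ← pderiv_map, map_C,
    eval_C]
  rfl

end PolyAtAlgebra

section Decomposition

variable {R : Type*} [CommRing R]

lemma mem_span_X_of_support {σ κ : Type*} {ι : κ → σ} {q : MvPolynomial σ R}
    (hq : ∀ e, (¬ ∃ j, e (ι j) ≠ 0) → coeff e q = 0) :
    q ∈ Ideal.span (range fun j => (X (ι j) : MvPolynomial σ R)) := by
  have h := (mem_ideal_span_X_image (R := R) (x := q) (s := range ι)).2 fun e he => by
    by_contra hcon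
    refine mem_support_iff.1 he (hq e ?_)
    rintro ⟨j, hj⟩
    exact hcon ⟨ι j, ⟨j, rfl⟩, hj⟩
  rwa [← range_comp] at h

/-- A polynomial of second order all of whose monomials contain one of the given variables is a
combination of these variables, with coefficients that have no constant terms. -/
lemma exists_linear_factorization {σ κ : Type*} [Fintype κ] {ι : κ → σ} (hι : ι.Injective)
    {q : MvPolynomial σ R} (hq2 : q ∈ idealOfVars σ R ^ 2)
    (hq : ∀ e, (¬ ∃ j, e (ι j) ≠ 0) → coeff e q = 0) :
    ∃ G : κ → MvPolynomial σ R, q = ∑ j, G j * X (ι j) ∧ ∀ j, coeff 0 (G j) = 0 := by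
  classical
  obtain ⟨G, hG⟩ := (Ideal.mem_span_range_iff_exists_fun).1 (mem_span_X_of_support hq)
  refine ⟨G, hG.symm, fun j => ?_⟩
  have h := (mem_pow_idealOfVars_iff' 2 q).1 hq2 (Finsupp.single (ι j) 1) (by simp)
  rw [← hG, coeff_sum, Finset.sum_eq_single j] at h
  · simpa [coeff_mul_X'] using h
  · intro k _ hk
    rw [coeff_mul_X', if_neg]
    rw [Finsupp.support_single _ one_ne_zero, Finset.mem_singleton]
    exact fun h => hk (hι h)
  · simp

variable {m n l : ℕ}

/-- The part of a polynomial in the centre variables only. -/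
def centrePart :
    MvPolynomial (Fin m ⊕ Fin n ⊕ Fin l) R →ₐ[R] MvPolynomial (Fin m ⊕ Fin n ⊕ Fin l) R :=
  bind₁ (Sum.elim (fun i => X (.inl i)) 0)

lemma exists_bilinear_factorization {q : MvPolynomial (Fin m ⊕ Fin n ⊕ Fin l) R}
    (hq : ∀ e, (¬ ((∃ j, e (.inr (.inl j)) ≠ 0) ↔ ∃ k, e (.inr (.inr k)) ≠ 0)) → coeff e q = 0) :
    ∃ F : Fin n → Fin l → MvPolynomial (Fin m ⊕ Fin n ⊕ Fin l) R,
      q = centrePart q + ∑ j, ∑ k, F j k * (X (.inr (.inl j)) * X (.inr (.inr k))) := by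
  classical
  have hmem : q - centrePart q ∈ Ideal.span (range fun z : Fin n × Fin l =>
      (X (.inr (.inl z.1)) * X (.inr (.inr z.2)) : MvPolynomial (Fin m ⊕ Fin n ⊕ Fin l) R)) := by
    have hsum : q - centrePart q = ∑ e ∈ q.support,
        (monomial e (coeff e q) - centrePart (monomial e (coeff e q))) := by
      rw [Finset.sum_sub_distrib, ← map_sum, support_sum_monomial_coeff]
    rw [hsum]
    refine Ideal.sum_mem _ fun e he => ?_
    have hret := not_imp_comm.1 (hq e) (mem_support_iff.1 he)
    have hkill : ∀ i, e (.inr i) ≠ 0 → centrePart (monomial e (coeff e q)) = 0 := by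
      intro i hi
      rw [centrePart, bind₁_monomial, Finset.prod_eq_zero (i := .inr i), mul_zero]
      · simpa using hi
      · simp [hi]
    by_cases hY : ∃ j, e (.inr (.inl j)) ≠ 0
    · obtain ⟨j, hj⟩ := hY
      obtain ⟨k, hk⟩ := hret.1 ⟨j, hj⟩
      rw [hkill _ hj, sub_zero]
      have hle : Finsupp.single (.inr (.inl j)) 1 + Finsupp.single (.inr (.inr k)) 1 ≤ e := by
        intro i
        rcases i with i | i | i
        · simp
        · by_cases h : j = i
          · subst h
            simpa using Nat.one_le_iff_ne_zero.2 hj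
          · simp [h]
        · by_cases h : k = i
          · subst h
            simpa using Nat.one_le_iff_ne_zero.2 hk
          · simp [h]
      have hfac : monomial e (coeff e q) = monomial (e - (Finsupp.single (.inr (.inl j)) 1 +
          Finsupp.single (.inr (.inr k)) 1)) (coeff e q) *
          (X (.inr (.inl j)) * X (.inr (.inr k))) := by
        rw [X, X, monomial_mul, monomial_mul, mul_one, mul_one, tsub_add_cancel_of_le hle]
      rw [hfac]
      exact Ideal.mul_mem_left _ _ (Ideal.subset_span ⟨(j, k), rfl⟩)
    · have hZ := mt hret.2 hY
      have : centrePart (monomial e (coeff e q)) = monomial e (coeff e q) := by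
        push Not at hY hZ
        rw [centrePart, bind₁_monomial, monomial_eq, Finsupp.prod]
        congr 1
        refine Finset.prod_congr rfl fun i hi => ?_
        rcases i with i | i | i
        · rfl
        · exact absurd (hY i) (Finsupp.mem_support_iff.1 hi)
        · exact absurd (hZ i) (Finsupp.mem_support_iff.1 hi)
      rw [this, sub_self]
      exact zero_mem _
  obtain ⟨F, hF⟩ := Ideal.mem_span_range_iff_exists_fun.1 hmem
  refine ⟨fun j k => F (j, k), ?_⟩
  rw [Fintype.sum_prod_type] at hF
  exact (add_eq_of_eq_sub' hF).symm

end Decomposition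

section BlockSystems

variable {m n l : ℕ}

lemma act_apply {k : ℕ} (M : Matrix (Fin k) (Fin k) ℝ) (v : Vec k) (i : Fin k) :
    act M v i = ∑ j, M i j * v j := by
  change (Matrix.toEuclideanCLM (n := Fin k) (𝕜 := ℝ) M v).ofLp i = _
  rw [Matrix.ofLp_toEuclideanCLM]
  rfl

lemma continuous_act (k : ℕ) : Continuous (act (k := k)) :=
  (Matrix.toEuclideanCLM (n := Fin k) (𝕜 := ℝ)).toAlgEquiv.toLinearMap.continuous_of_finiteDimensional

/-- The matrix of the linear part of a separated system. -/
def blockMatrix (A : Matrix (Fin m) (Fin m) ℝ) (B : Matrix (Fin n) (Fin n) ℝ)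
    (C : Matrix (Fin l) (Fin l) ℝ) :
    Matrix (Fin m ⊕ Fin n ⊕ Fin l) (Fin m ⊕ Fin n ⊕ Fin l) ℝ :=
  Matrix.fromBlocks A 0 0 (Matrix.fromBlocks B 0 0 C)

lemma sum_blockMatrix_mul (A : Matrix (Fin m) (Fin m) ℝ) (B : Matrix (Fin n) (Fin n) ℝ)
    (C : Matrix (Fin l) (Fin l) ℝ) (u : State m n l) (i : Fin m ⊕ Fin n ⊕ Fin l) :
    ∑ j, blockMatrix A B C i j * coords u j =
      coords ((act A u.1, act B u.2.1, act C u.2.2) : State m n l) i := by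
  rcases i with i | i | i <;>
    simp [blockMatrix, coords, act_apply, Fintype.sum_sum_type]

/-- The nonlinear part of a separated system. -/
def SeparatedSystem.nonlinear (S : SeparatedSystem m n l) (t : ℝ) (u : State m n l) :
    State m n l := (S.f t u, S.g t u, S.h t u)

lemma SeparatedSystem.field_eq (S : SeparatedSystem m n l) (t : ℝ) (u : State m n l) :
    S.field t u = ((act S.A u.1, act S.B u.2.1, act S.C u.2.2) : State m n l) +
      S.nonlinear t u := rfl

lemma SeparatedSystem.Assumption.nonlinear_coord {S : SeparatedSystem m n l} {I : Set ℝ}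
    {d : Set (State m n l)} {α β : ℝ} {P : ℕ} (hS : S.Assumption I d α β P)
    (i : Fin m ⊕ Fin n ⊕ Fin l) :
    IsClassC P I d (fun t u => coords (S.nonlinear t u) i) ∧
      IsOrder 2 I fun t u => coords (S.nonlinear t u) i := by
  rcases i with i | i | i
  · exact ⟨hS.smooth_f.clm hS.domain_open (EuclideanSpace.proj (𝕜 := ℝ) i),
      hS.order_f.clm (EuclideanSpace.proj (𝕜 := ℝ) i)⟩
  · exact ⟨hS.smooth_g.clm hS.domain_open (EuclideanSpace.proj (𝕜 := ℝ) i),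
      hS.order_g.clm (EuclideanSpace.proj (𝕜 := ℝ) i)⟩
  · exact ⟨hS.smooth_h.clm hS.domain_open (EuclideanSpace.proj (𝕜 := ℝ) i),
      hS.order_h.clm (EuclideanSpace.proj (𝕜 := ℝ) i)⟩

end BlockSystems

section NormalFormOfPolynomials

variable {m n l : ℕ} {I : Set ℝ}

/-- The monomials that are kept in a normal form system. -/
def IsNormalMonomial : Fin m ⊕ Fin n ⊕ Fin l → (Fin m ⊕ Fin n ⊕ Fin l →₀ ℕ) → Prop
  | .inl _, e => (∃ j, e (.inr (.inl j)) ≠ 0) ↔ ∃ k, e (.inr (.inr k)) ≠ 0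
  | .inr (.inl _), e => ∃ j, e (.inr (.inl j)) ≠ 0
  | .inr (.inr _), e => ∃ k, e (.inr (.inr k)) ≠ 0

/-- A tuple of polynomials with normal monomials only is the nonlinear part of a normal form. -/
theorem exists_normalForm {ν : Fin m ⊕ Fin n ⊕ Fin l →
      MvPolynomial (Fin m ⊕ Fin n ⊕ Fin l) (continuousOnRing I)}
    (hν2 : ∀ i, ν i ∈ idealOfVars _ _ ^ 2)
    (hν : ∀ i e, ¬ IsNormalMonomial i e → coeff e (ν i) = 0) :
    ∃ N : NormalForm m n l, N.IsAdmissible I ∧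
      (∀ t, N.G t 0 = 0) ∧ (∀ t, N.H t 0 = 0) ∧
      ContinuousOn (fun z : ℝ × State m n l => N.G z.1 z.2) (I ×ˢ univ) ∧
      ContinuousOn (fun z : ℝ × State m n l => N.H z.1 z.2) (I ×ˢ univ) ∧
      ∀ A B C t U i, coords (N.field A B C t U) i =
        ∑ j, blockMatrix A B C i j * coords U j + polyAt (ν i) t (coords U) := by
  have hF : ∀ i : Fin m, ∃ F : Fin n → Fin l → MvPolynomial (Fin m ⊕ Fin n ⊕ Fin l)
      (continuousOnRing I), ν (.inl i) = centrePart (ν (.inl i)) +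
        ∑ j, ∑ k, F j k * (X (.inr (.inl j)) * X (.inr (.inr k))) := fun i =>
    exists_bilinear_factorization fun e he => hν (.inl i) e he
  have hG : ∀ i : Fin n, ∃ G : Fin n → MvPolynomial (Fin m ⊕ Fin n ⊕ Fin l) (continuousOnRing I),
      ν (.inr (.inl i)) = ∑ j, G j * X (.inr (.inl j)) ∧ ∀ j, coeff 0 (G j) = 0 := fun i =>
    exists_linear_factorization (ι := fun j => Sum.inr (Sum.inl j))
      (Sum.inr_injective.comp Sum.inl_injective) (hν2 _) fun e he => hν (.inr (.inl i)) e he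
  have hH : ∀ i : Fin l, ∃ H : Fin l → MvPolynomial (Fin m ⊕ Fin n ⊕ Fin l) (continuousOnRing I),
      ν (.inr (.inr i)) = ∑ j, H j * X (.inr (.inr j)) ∧ ∀ j, coeff 0 (H j) = 0 := fun i =>
    exists_linear_factorization (ι := fun j => Sum.inr (Sum.inr j))
      (Sum.inr_injective.comp Sum.inr_injective) (hν2 _) fun e he => hν (.inr (.inr i)) e he
  choose F hF using hF
  choose G hG hG0 using hG
  choose H hH hH0 using hH
  let N : NormalForm m n l :=
    { Fc := fun t X => WithLp.toLp 2 fun i => polyAt (ν (.inl i)) t (coords ((X, 0, 0) : State m n l))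
      F := fun t U i j k => polyAt (F i j k) t (coords U)
      G := fun t U => Matrix.of fun i j => polyAt (G i j) t (coords U)
      H := fun t U => Matrix.of fun i j => polyAt (H i j) t (coords U) }
  have hpure : ∀ i t (U : State m n l), polyAt (ν i) t (coords ((U.1, 0, 0) : State m n l)) =
      polyAt (centrePart (ν i)) t (coords U) := by
    intro i t U
    rw [centrePart, polyAt_bind₁]
    congr 1
    funext i
    rcases i with i | i | i <;> simp [coords, polyAt]
  have hcentre : ∀ t U i, N.centre t U i = polyAt (ν (.inl i)) t (coords U) := by
    intro t U i
    conv_rhs => rw [hF i, polyAt_add]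
    change polyAt (ν (.inl i)) t (coords ((U.1, 0, 0) : State m n l)) +
      ∑ j, ∑ k, polyAt (F i j k) t (coords U) * U.2.1 j * U.2.2 k = _
    rw [hpure]
    simp [polyAt, coords, mul_assoc]
  have hGeq : ∀ t U i, act (N.G t U) U.2.1 i = polyAt (ν (.inr (.inl i))) t (coords U) := by
    intro t U i
    rw [hG, act_apply]
    simp [N, polyAt, coords]
  have hHeq : ∀ t U i, act (N.H t U) U.2.2 i = polyAt (ν (.inr (.inr i))) t (coords U) := by
    intro t U i
    rw [hH, act_apply]
    simp [N, polyAt, coords]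
  have hord : ∀ i, IsOrder 2 I fun t (U : State m n l) => polyAt (ν i) t (coords U) := fun i =>
    isOrder_polyAt fun t _ => map_mem_pow_idealOfVars _ (hν2 i)
  have hvec : ∀ {k : ℕ} {w : ℝ → State m n l → Vec k}, (∀ i, IsOrder 2 I fun t U => w t U i) →
      IsOrder 2 I w := fun {k} w h =>
    (isOrder_pi (w := fun t U i => w t U i) h).clm
      (EuclideanSpace.equiv (Fin k) ℝ).symm.toContinuousLinearMap
  have hzero : ∀ (q : MvPolynomial (Fin m ⊕ Fin n ⊕ Fin l) (continuousOnRing I)) (t : ℝ),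
      coeff 0 q = 0 → polyAt q t (coords (0 : State m n l)) = 0 := by
    intro q t hq
    have h0 : coords (0 : State m n l) = 0 := map_zero (coordsEquiv m n l)
    rw [h0, polyAt, eval_zero, constantCoeff_eq, coeff_map, hq, map_zero]
  have hcont : ∀ q : MvPolynomial (Fin m ⊕ Fin n ⊕ Fin l) (continuousOnRing I),
      ContinuousOn (fun z : ℝ × State m n l => polyAt q z.1 (coords z.2)) (I ×ˢ univ) := by
    intro q
    have h := (contDiffOn_uncurry_polyAt (k := 0) fun e => contDiffOn_zero.2 (coeff e q).2).continuousOn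
    refine h.comp (f := fun z : ℝ × State m n l => (z.1, coords z.2)) ?_ fun z hz => ⟨hz.1, mem_univ _⟩
    exact (continuous_fst.prodMk ((coordsEquiv m n l).continuous.comp continuous_snd)).continuousOn
  refine ⟨N, ⟨fun i => ?_, fun i j k => isMultinomial_zero_polyAt _,
    fun i j => isMultinomial_zero_polyAt _, fun i j => isMultinomial_zero_polyAt _,
    hvec fun i => ?_, hvec fun i => ?_, hvec fun i => ?_⟩, ?_, ?_, ?_, ?_, ?_⟩
  · have := isMultinomial_zero_polyAt (centrePart (ν (.inl i)))
    simp_rw [← hpure] at this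
    exact this
  · exact (hord _).congr fun t _ U => hcentre t U i
  · exact (hord _).congr fun t _ U => hGeq t U i
  · exact (hord _).congr fun t _ U => hHeq t U i
  · intro t
    ext i j
    exact hzero _ t (hG0 i j)
  · intro t
    ext i j
    exact hzero _ t (hH0 i j)
  · exact continuousOn_pi.2 fun i => continuousOn_pi.2 fun j => hcont (G i j)
  · exact continuousOn_pi.2 fun i => continuousOn_pi.2 fun j => hcont (H i j)
  · intro A B C t U i
    rw [sum_blockMatrix_mul]
    rcases i with i | i | i
    · exact congrArg (act A U.1 i + ·) (hcentre t U i)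
    · change act (B + N.G t U) U.2.1 i = act B U.2.1 i + _
      rw [← hGeq]
      simp [act]
    · change act (C + N.H t U) U.2.2 i = act C U.2.2 i + _
      rw [← hHeq]
      simp [act]

end NormalFormOfPolynomials

section Transform

variable {m n l : ℕ} {I : Set ℝ}

/-- The time dependent map of the state space with the given polynomial coordinates. -/
def polyTransform (q : Fin m ⊕ Fin n ⊕ Fin l →
      MvPolynomial (Fin m ⊕ Fin n ⊕ Fin l) (continuousOnRing I)) (t : ℝ) (U : State m n l) :
    State m n l :=
  (coordsEquiv m n l).symm fun i => polyAt (q i) t (coords U)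

lemma isOrder_coordsEquiv_symm {p : ℕ} {w : ℝ → State m n l → Fin m ⊕ Fin n ⊕ Fin l → ℝ}
    (h : ∀ i, IsOrder p I fun t u => w t u i) :
    IsOrder p I fun t u => (coordsEquiv m n l).symm (w t u) :=
  (isOrder_pi h).clm ((coordsEquiv m n l).symm : (Fin m ⊕ Fin n ⊕ Fin l → ℝ) →L[ℝ] State m n l)

variable {q q' : Fin m ⊕ Fin n ⊕ Fin l →
  MvPolynomial (Fin m ⊕ Fin n ⊕ Fin l) (continuousOnRing I)}

@[simp]
lemma coords_polyTransform (t : ℝ) (U : State m n l) (i : Fin m ⊕ Fin n ⊕ Fin l) :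
    coords (polyTransform q t U) i = polyAt (q i) t (coords U) := by
  rw [polyTransform, coords_coordsEquiv_symm]

lemma contDiff_polyTransform (t : ℝ) {k : WithTop ℕ∞} : ContDiff ℝ k (polyTransform q t) :=
  (coordsEquiv m n l).symm.contDiff.comp (contDiff_pi.2 fun i =>
    (contDiff_polyAt (q i) t).comp (coordsEquiv m n l).contDiff)

lemma contDiffOn_uncurry_polyTransform
    (hq : ∀ i e, ContDiffOn ℝ 1 (coeff e (q i)).1 I) :
    ContDiffOn ℝ 1 (Function.uncurry (polyTransform q)) (I ×ˢ univ) := by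
  refine (coordsEquiv m n l).symm.contDiff.comp_contDiffOn (contDiffOn_pi.2 fun i => ?_)
  exact (contDiffOn_uncurry_polyAt (hq i)).comp
    (f := fun z : ℝ × State m n l => (z.1, coordsEquiv m n l z.2))
    (ContDiff.contDiffOn (by fun_prop)) fun z hz => ⟨hz.1, mem_univ _⟩

lemma deriv_polyTransform {t : ℝ}
    (h : ∀ i e, HasDerivAt (coeff e (q i)).1 ((coeff e (q' i)).1 t) t) (U : State m n l) :
    deriv (fun s => polyTransform q s U) t = polyTransform q' t U :=
  ((coordsEquiv m n l).symm.hasFDerivAt.comp_hasDerivAt t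
    (hasDerivAt_pi.2 fun i => hasDerivAt_polyAt (h i) (coords U))).deriv

lemma coords_fderiv_polyTransform (t : ℝ) (U V : State m n l) (i : Fin m ⊕ Fin n ⊕ Fin l) :
    coords (fderiv ℝ (polyTransform q t) U V) i =
      ∑ j, eval (coords U) (pderiv j (map (atTime I t) (q i))) * coords V j := by
  have h : HasFDerivAt (fun W => coords (polyTransform q t W) i)
      ((∑ j, eval (coords U) (pderiv j (map (atTime I t) (q i))) •
        ContinuousLinearMap.proj (R := ℝ) (φ := fun _ => ℝ) j).comp
          (coordsEquiv m n l : State m n l →L[ℝ] _)) U := by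
    simp_rw [coords_polyTransform]
    exact (hasFDerivAt_eval (map (atTime I t) (q i)) (coords U)).comp U
      (coordsEquiv m n l).hasFDerivAt
  have hd : DifferentiableAt ℝ (polyTransform q t) U :=
    (contDiff_polyTransform (q := q) (k := 1) t).differentiable one_ne_zero U
  let T : State m n l →L[ℝ] ℝ := (ContinuousLinearMap.proj (R := ℝ) (φ := fun _ => ℝ) i).comp
    (coordsEquiv m n l : State m n l →L[ℝ] Fin m ⊕ Fin n ⊕ Fin l → ℝ)
  have h' : HasFDerivAt (fun W => coords (polyTransform q t W) i)
      (T.comp (fderiv ℝ (polyTransform q t) U)) U := T.hasFDerivAt.comp U hd.hasFDerivAt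
  have := congrArg (fun T : State m n l →L[ℝ] ℝ => T V) (h'.unique h)
  simpa [T] using this

lemma isOrder_polyTransform_sub
    (hq : ∀ i, q i - X i ∈ idealOfVars (Fin m ⊕ Fin n ⊕ Fin l) (continuousOnRing I) ^ 2) :
    IsOrder 2 I fun t (U : State m n l) => polyTransform q t U - U := by
  have h := isOrder_coordsEquiv_symm (w := fun t (U : State m n l) i =>
    polyAt (q i - X i) t (coords U))
    fun i => isOrder_polyAt fun t _ => map_mem_pow_idealOfVars _ (hq i)
  refine h.congr fun t _ U => (coordsEquiv m n l).injective ?_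
  rw [map_sub]
  funext i
  simp [polyAt]

lemma isOrder_polyTransform {p : ℕ}
    (hq : ∀ t ∈ I, ∀ i, map (atTime I t) (q i) ∈ idealOfVars (Fin m ⊕ Fin n ⊕ Fin l) ℝ ^ p) :
    IsOrder p I (polyTransform q : ℝ → State m n l → State m n l) :=
  isOrder_coordsEquiv_symm fun i => isOrder_polyAt fun t ht => hq t ht i

end Transform

section Pushforward

open Classical in
/-- The vector field of `U' = N(t,U)` in the coordinates `u = φ(t,U)`, continued by `F` outside the
image of the region where `φ` is close to the identity. -/
def pushforwardField {E : Type*} [NormedAddCommGroup E] [NormedSpace ℝ E] (φ N F : ℝ → E → E)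
    (t : ℝ) (u : E) : E :=
  if h : ∃ U ∈ nearIdentityRegion (φ t), φ t U = u then
    deriv (fun s => φ s h.choose) t + fderiv ℝ (φ t) h.choose (N t h.choose)
  else F t u

lemma pushforwardField_apply {E : Type*} [NormedAddCommGroup E] [NormedSpace ℝ E]
    {φ : ℝ → E → E} (N F : ℝ → E → E) {t : ℝ} (hφ : Differentiable ℝ (φ t)) {U : E}
    (hU : U ∈ nearIdentityRegion (φ t)) :
    pushforwardField φ N F t (φ t U) = deriv (fun s => φ s U) t + fderiv ℝ (φ t) U (N t U) := by
  have h : ∃ V ∈ nearIdentityRegion (φ t), φ t V = φ t U := ⟨U, hU, rfl⟩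
  have hV : h.choose = U :=
    injOn_nearIdentityRegion hφ h.choose_spec.1 hU h.choose_spec.2
  rw [pushforwardField, dif_pos h, hV]

variable {m n l : ℕ} {I : Set ℝ}

lemma isOrder_sub_of_conjugacy {p : ℕ} (hI : IsOpen I) {φ v F w₁ w₂ : ℝ → State m n l → State m n l}
    (hΦ : ContDiffOn ℝ 1 (Function.uncurry φ) (I ×ˢ univ))
    (hφ : ∀ t ∈ I, Differentiable ℝ (φ t)) (h0 : ∀ t ∈ I, φ t 0 = 0)
    (hid : ∀ t ∈ I, fderiv ℝ (φ t) 0 = ContinuousLinearMap.id ℝ (State m n l))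
    (h₁ : IsOrder p I w₁) (h₂ : IsOrder p I w₂)
    (h : ∀ t ∈ I, ∀ U ∈ nearIdentityRegion (φ t),
      v t (φ t U) - F t (φ t U) = w₁ t U + w₂ t (φ t U)) :
    IsOrder p I fun t u => v t u - F t u := by
  rw [isOrder_iff] at *
  intro a b hab
  obtain ⟨c₁, r₁, hc₁, hr₁, h₁⟩ := h₁ a b hab
  obtain ⟨c₂, r₂, hc₂, hr₂, h₂⟩ := h₂ a b hab
  obtain ⟨ρ, hρ, hreg⟩ := exists_ball_subset_nearIdentityRegion hI hΦ hid hab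
  refine ⟨c₁ * 2 ^ p + c₂, min (ρ / 4) (min (r₁ / 2) r₂), by positivity, by positivity,
    fun t ht u hu => ?_⟩
  have hu1 : ‖u‖ < ρ / 4 := hu.trans_le (min_le_left _ _)
  have hu2 : ‖u‖ < r₁ / 2 := hu.trans_le ((min_le_right _ _).trans (min_le_left _ _))
  have hu3 : ‖u‖ < r₂ := hu.trans_le ((min_le_right _ _).trans (min_le_right _ _))
  have hsub : Metric.closedBall 0 (ρ / 2) ⊆ nearIdentityRegion (φ t) :=
    (Metric.closedBall_subset_ball (by linarith)).trans (hreg t ht)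
  obtain ⟨U, hU, rfl⟩ := closedBall_subset_image (hφ t (hab ht)) (h0 t (hab ht)) (by positivity)
    hsub (mem_closedBall_zero_iff.2 (by linarith) : u ∈ Metric.closedBall 0 (ρ / 2 / 2))
  have hUn : ‖U‖ ≤ 2 * ‖φ t U‖ := by
    have := norm_sub_le_of_mem (hφ t (hab ht)) (hsub hU) (hreg t ht (Metric.mem_ball_self hρ))
    simpa [h0 t (hab ht)] using this
  rw [h t (hab ht) U (hsub hU), add_mul]
  refine (norm_add_le _ _).trans (add_le_add ?_ (h₂ t ht _ hu3))
  refine (h₁ t ht U (by linarith)).trans ?_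
  rw [mul_assoc, ← mul_pow]
  exact mul_le_mul_of_nonneg_left (pow_le_pow_left₀ (norm_nonneg _) hUn p) hc₁

end Pushforward

section Invariance

variable {m n l : ℕ}

lemma norm_act_add_le {k : ℕ} (M G : Matrix (Fin k) (Fin k) ℝ) (hG : norm2 G ≤ 1) (v : Vec k) :
    ‖act (M + G) v‖ ≤ (norm2 M + 1) * ‖v‖ := by
  have h : act (M + G) = act M + act G := by simp [act]
  rw [h]
  refine ((act M + act G).le_opNorm v).trans (mul_le_mul_of_nonneg_right ?_ (norm_nonneg v))
  exact (norm_add_le _ _).trans (add_le_add le_rfl hG)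

lemma NormalForm.centre_eq {N : NormalForm m n l} {t : ℝ} {U : State m n l}
    (h : U.2.1 = 0 ∨ U.2.2 = 0) : N.centre t U = N.centre t (U.1, 0, 0) := by
  rcases h with h | h <;> simp [NormalForm.centre, h]

/-- The coordinate subspaces are invariant for a normal form system. -/
theorem NormalForm.mem_subspace_of_solution (N : NormalForm m n l) (A : Matrix (Fin m) (Fin m) ℝ)
    (B : Matrix (Fin n) (Fin n) ℝ) (C : Matrix (Fin l) (Fin l) ℝ) {J : Set ℝ}
    (hJ : J.OrdConnected) {W : ℝ → State m n l} {K : ℝ}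
    (hW : ∀ t ∈ J, HasDerivWithinAt W (N.field A B C t (W t)) J t)
    (hG : ∀ t ∈ J, norm2 (N.G t (W t)) ≤ 1) (hH : ∀ t ∈ J, norm2 (N.H t (W t)) ≤ 1)
    (hC : ∀ t ∈ J, ‖N.centre t ((W t).1, 0, 0)‖ ≤ K * ‖(W t).1‖) (i : ManifoldKind) {t₀ t : ℝ}
    (ht₀ : t₀ ∈ J) (h₀ : W t₀ ∈ i.subspace) (ht : t ∈ J) : W t ∈ i.subspace := by
  have hY : (W t₀).2.1 = 0 → ∀ t ∈ J, (W t).2.1 = 0 := fun h t ht =>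
    eq_zero_of_norm_deriv_le hJ (f := fun s => (W s).2.1) (fun s hs => (hW s hs).snd.fst)
      (fun s hs => norm_act_add_le B _ (hG s hs) _) ht₀ h ht
  have hZ : (W t₀).2.2 = 0 → ∀ t ∈ J, (W t).2.2 = 0 := fun h t ht =>
    eq_zero_of_norm_deriv_le hJ (f := fun s => (W s).2.2) (fun s hs => (hW s hs).snd.snd)
      (fun s hs => norm_act_add_le C _ (hH s hs) _) ht₀ h ht
  have hX : (∀ s ∈ J, (W s).2.1 = 0 ∨ (W s).2.2 = 0) → (W t₀).1 = 0 → ∀ t ∈ J, (W t).1 = 0 := by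
    intro hs h t ht
    refine eq_zero_of_norm_deriv_le hJ (f := fun s => (W s).1) (K := norm2 A + K)
      (fun s hs => (hW s hs).fst) (fun s hsJ => ?_) ht₀ h ht
    change ‖act A (W s).1 + N.centre s (W s)‖ ≤ _
    rw [NormalForm.centre_eq (hs s hsJ), add_mul]
    exact (norm_add_le _ _).trans (add_le_add ((act A).le_opNorm _) (hC s hsJ))
  cases i with
  | centre => exact ⟨hY h₀.1 t ht, hZ h₀.2 t ht⟩
  | stable => exact ⟨hX (fun s hs => Or.inr (hZ h₀.2 s hs)) h₀.1 t ht, hZ h₀.2 t ht⟩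
  | unstable => exact ⟨hX (fun s hs => Or.inl (hY h₀.2 s hs)) h₀.1 t ht, hY h₀.2 t ht⟩
  | centreStable => exact hZ h₀ t ht
  | centreUnstable => exact hY h₀ t ht

end Invariance

section Existence

variable {m n l : ℕ} {I : Set ℝ}

/-- A normal form system and a near identity transform that conjugate a separated system to the normal
form up to terms of order `p`. -/
theorem SeparatedSystem.Assumption.exists_conjugacy {S : SeparatedSystem m n l}
    {d : Set (State m n l)} {α β : ℝ} {P : ℕ} (hS : S.Assumption I d α β P) {p : ℕ} (hp : 2 ≤ p)
    (hpP : p ≤ P) :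
    ∃ (N : NormalForm m n l) (φ : ℝ → State m n l → State m n l),
      N.IsAdmissible I ∧ IsNearIdentity I φ ∧
      (∀ t, N.G t 0 = 0) ∧ (∀ t, N.H t 0 = 0) ∧
      ContinuousOn (fun z : ℝ × State m n l => N.G z.1 z.2) (I ×ˢ univ) ∧
      ContinuousOn (fun z : ℝ × State m n l => N.H z.1 z.2) (I ×ˢ univ) ∧
      ContDiffOn ℝ 1 (Function.uncurry φ) (I ×ˢ univ) ∧ (∀ t, ContDiff ℝ P (φ t)) ∧
      ∃ w₁ w₂ : ℝ → State m n l → State m n l, IsOrder p I w₁ ∧ IsOrder p I w₂ ∧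
        ∀ t ∈ I, ∀ U, deriv (fun s => φ s U) t + fderiv ℝ (φ t) U (N.field S.A S.B S.C t U) -
          S.field t (φ t U) = w₁ t U + w₂ t (φ t U) := by
  have hT := fun i => exists_taylor_polynomial hp hpP hS.domain_open hS.zero_mem
    (hS.nonlinear_coord i).1 (hS.nonlinear_coord i).2
  choose f hf2 hf using hT
  obtain ⟨q, q', ν, h⟩ := exists_formalConjugacy hS.time_open hS.time_interval hS.time_nonempty
    (blockMatrix S.A S.B S.C) hf2 IsNormalMonomial hp
  obtain ⟨N, hN, hG0, hH0, hGc, hHc, hNf⟩ := exists_normalForm h.order_two h.retained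
  have hq : ∀ i e, ContDiffOn ℝ 1 (coeff e (q i)).1 I := fun i e =>
    contDiffOn_one_of_hasDerivAt hS.time_open (coeff e (q' i)).2 (h.time_deriv i e)
  refine ⟨N, polyTransform q, hN, ⟨fun i => ?_, isOrder_polyTransform_sub h.near_identity⟩, hG0,
    hH0, hGc, hHc, contDiffOn_uncurry_polyTransform hq, fun t => contDiff_polyTransform t,
    polyTransform (conjResidual ((blockMatrix S.A S.B S.C).map (algebraMap ℝ _)) f q q' ν),
    fun t u => (coordsEquiv m n l).symm fun i =>
      -(coords (S.nonlinear t u) i - polyAt (f i) t (coords u)), ?_, ?_, fun t ht U => ?_⟩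
  · simp_rw [coords_polyTransform]
    exact isMultinomial_polyAt fun e => hq i e
  · exact isOrder_polyTransform h.order_residual
  · exact isOrder_coordsEquiv_symm fun i => (hf i).clm (-ContinuousLinearMap.id ℝ ℝ)
  · apply (coordsEquiv m n l).injective
    funext i
    rw [deriv_polyTransform (q' := q') fun i e => h.time_deriv i e t ht, S.field_eq]
    simp only [map_add, map_sub, Pi.add_apply, Pi.sub_apply, coordsEquiv_apply,
      coords_polyTransform, coords_fderiv_polyTransform, coords_coordsEquiv_symm,
      ← sum_blockMatrix_mul, hNf, polyAt_conjResidual, polyAt_add, polyAt_linearField]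
    have : coords (polyTransform q t U) = fun i => polyAt (q i) t (coords U) :=
      funext fun i => coords_polyTransform t U i
    rw [this]
    ring

/-- A conjugacy to a normal form system yields invariant manifolds over compact time intervals. -/
theorem NormalForm.exists_domains {N : NormalForm m n l} {φ v : ℝ → State m n l → State m n l}
    {A : Matrix (Fin m) (Fin m) ℝ} {B : Matrix (Fin n) (Fin n) ℝ} {C : Matrix (Fin l) (Fin l) ℝ}
    {P : ℕ} (hP : 1 ≤ P) {d : Set (State m n l)} (hd : IsOpen d) (hd0 : (0 : State m n l) ∈ d)
    (hI : IsOpen I) (hN : N.IsAdmissible I) (hG0 : ∀ t, N.G t 0 = 0) (hH0 : ∀ t, N.H t 0 = 0)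
    (hGc : ContinuousOn (fun z : ℝ × State m n l => N.G z.1 z.2) (I ×ˢ univ))
    (hHc : ContinuousOn (fun z : ℝ × State m n l => N.H z.1 z.2) (I ×ˢ univ))
    (hΦ : ContDiffOn ℝ 1 (Function.uncurry φ) (I ×ˢ univ)) (hφ : ∀ t, ContDiff ℝ P (φ t))
    (h0 : ∀ t ∈ I, φ t 0 = 0)
    (hid : ∀ t ∈ I, fderiv ℝ (φ t) 0 = ContinuousLinearMap.id ℝ (State m n l))
    (hv : ∀ t ∈ I, ∀ U ∈ nearIdentityRegion (φ t), v t (φ t U) =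
      deriv (fun s => φ s U) t + fderiv ℝ (φ t) U (N.field A B C t U))
    {α β μ δ : ℝ} (hδ : 0 ≤ δ) (hα : α < μ - δ) (hβ : μ + δ < β) (Q : Matrix (Fin n) (Fin n) ℝ)
    (R : Matrix (Fin l) (Fin l) ℝ) {a b : ℝ} (hab : Icc a b ⊆ I) :
    ∃ (DD D : Set (State m n l)) (dμ : ℝ → Set (State m n l)),
      IsEmergencePreserving N α β μ δ Q R (Icc a b) DD ∧
      IsStarShaped D ∧ D ⊆ DD ∧
      (∀ t ∈ Icc a b, IsDiffeoOnto P (φ t) D (dμ t) ∧ IsConnected (dμ t) ∧ dμ t ⊆ d) ∧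
      (∃ r > 0, ∀ t ∈ Icc a b, Metric.ball 0 r ⊆ dμ t) ∧
      IsPushforward v φ (N.field A B C) (Icc a b) D ∧
      ∀ i : ManifoldKind, IsIntegralIn v (Icc a b) dμ (fun t => i.image φ DD D t) := by
  have hdiff : ∀ t, Differentiable ℝ (φ t) := fun t =>
    (hφ t).differentiable (by exact_mod_cast Nat.one_le_iff_ne_zero.1 hP)
  have hnG : ContinuousOn (fun z : ℝ × State m n l => norm2 (N.G z.1 z.2)) (I ×ˢ univ) :=
    ((continuous_act n).comp_continuousOn hGc).norm
  have hnH : ContinuousOn (fun z : ℝ × State m n l => norm2 (N.H z.1 z.2)) (I ×ˢ univ) :=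
    ((continuous_act l).comp_continuousOn hHc).norm
  have hz : ∀ k : ℕ, norm2 (0 : Matrix (Fin k) (Fin k) ℝ) = 0 := fun k => by simp [norm2, act]
  obtain ⟨r₁, hr₁, h₁⟩ := exists_ball_subset_nearIdentityRegion hI hΦ hid hab
  obtain ⟨r₂, hr₂, h₂⟩ := exists_ball_forall_lt (ε := 1) hI hnG hab fun t _ => by simp [hG0, hz]
  obtain ⟨r₃, hr₃, h₃⟩ := exists_ball_forall_lt (ε := 1) hI hnH hab fun t _ => by simp [hH0, hz]
  obtain ⟨r₄, hr₄, h₄⟩ := exists_ball_forall_lt (ε := β - (μ + δ)) hI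
    ((continuousOn_const (c := cond2 Q)).mul hnG |>.sup ((continuousOn_const (c := cond2 R)).mul hnH))
    hab fun t _ => by simpa [hG0, hH0, hz] using hβ
  obtain ⟨r₅, hr₅, h₅⟩ := Metric.isOpen_iff.1 hd 0 hd0
  obtain ⟨c, r₆, hc, hr₆, h₆⟩ := isOrder_iff.1 hN.order_centre a b hab
  obtain ⟨r, hr, hl₁, hl₂, hl₃, hl₄, hl₅, hl₆⟩ : ∃ r > 0, r ≤ r₁ ∧ r ≤ r₂ ∧ r ≤ r₃ ∧ r ≤ r₄ ∧
      r ≤ r₅ / 2 ∧ r ≤ r₆ := by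
    refine ⟨min r₁ (min r₂ (min r₃ (min r₄ (min (r₅ / 2) r₆)))), by positivity, ?_⟩
    simp
  set D : Set (State m n l) := Metric.ball 0 r with hD
  have hDn : ∀ U ∈ D, ‖U‖ < r := fun U hU => mem_ball_zero_iff.1 hU
  have hreg : ∀ t ∈ Icc a b, D ⊆ nearIdentityRegion (φ t) := fun t ht =>
    (Metric.ball_subset_ball hl₁).trans (h₁ t ht)
  have hstar : IsStarShaped D := ⟨Metric.isOpen_ball, ⟨0, Metric.mem_ball_self hr⟩,
    (convex_ball _ _).starConvex (Metric.mem_ball_self hr)⟩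
  refine ⟨D, D, fun t => φ t '' D, ⟨hstar, fun t ht U hU ν hν => ?_⟩, hstar, subset_rfl,
    fun t ht => ⟨?_, ?_, ?_⟩, ⟨r / 4, by positivity, fun t ht u hu => ?_⟩,
    fun t ht U hU => hv t (hab ht) U (hreg t ht hU), fun i => ⟨fun t _ => ?_, ?_⟩⟩
  · have h : max (cond2 Q * norm2 (N.G t U)) (cond2 R * norm2 (N.H t U)) < β - (μ + δ) :=
      h₄ t ht U ((hDn U hU).trans_le hl₄)
    rcases hν with rfl | rfl
    · exact ⟨hα, by linarith⟩
    · exact ⟨by linarith, by linarith⟩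
  · obtain ⟨ho, ψ, hψ, hψc⟩ := exists_inverse_of_ball_subset hP (hφ t) (hreg t ht)
    exact ⟨Metric.isOpen_ball, ho,
      ((injOn_nearIdentityRegion (hdiff t)).mono (hreg t ht)).bijOn_image, (hφ t).contDiffOn,
      ψ, hψ, hψc⟩
  · exact ((convex_ball (0 : State m n l) r).isConnected ⟨0, Metric.mem_ball_self hr⟩).image _
      (hφ t).continuous.continuousOn
  · rintro _ ⟨U, hU, rfl⟩
    refine h₅ ?_
    have := norm_image_sub_le_of_mem (hdiff t) (hreg t ht hU)
      (hreg t ht (Metric.mem_ball_self hr))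
    rw [h0 t (hab ht), sub_zero, sub_zero] at this
    rw [mem_ball_zero_iff]
    linarith [hDn U hU]
  · have hsub : Metric.closedBall (0 : State m n l) (r / 2) ⊆ D :=
      Metric.closedBall_subset_ball (by linarith)
    refine image_mono hsub (closedBall_subset_image (hdiff t) (h0 t (hab ht)) (by positivity)
      (hsub.trans (hreg t ht)) ?_)
    rw [mem_ball_zero_iff] at hu
    rw [mem_closedBall_zero_iff]
    linarith
  · exact image_mono inter_subset_right
  · intro J w hJab hJ hw t₀ ht₀ hm t ht
    have hex : ∀ s, ∃ U, s ∈ J → U ∈ D ∧ φ s U = w s := by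
      intro s
      by_cases hs : s ∈ J
      · obtain ⟨U, hU⟩ := (hw s hs).1
        exact ⟨U, fun _ => hU⟩
      · exact ⟨0, fun h => absurd h hs⟩
    choose W hW using hex
    have hWd : ∀ s ∈ J, HasDerivWithinAt W (N.field A B C s (W s)) J s := by
      intro s hs
      refine HasDerivWithinAt.lift hI hΦ (hJab.trans hab) (fun s hs => hreg s (hJab hs)) hs
        (fun s hs => (hW s hs).1) (fun s hs => (hW s hs).2) ?_
      rw [← hv s (hab (hJab hs)) (W s) (hreg s (hJab hs) (hW s hs).1), (hW s hs).2]
      exact (hw s hs).2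
    have hmem : W t₀ ∈ i.subspace := by
      obtain ⟨V, ⟨⟨hV, _⟩, hVD⟩, hVw⟩ := hm
      have : V = W t₀ := injOn_nearIdentityRegion (hdiff t₀) (hreg t₀ (hJab ht₀) hVD)
        (hreg t₀ (hJab ht₀) (hW t₀ ht₀).1) (hVw.trans (hW t₀ ht₀).2.symm)
      exact this ▸ hV
    have hWn : ∀ s ∈ J, ‖W s‖ < r := fun s hs => hDn _ (hW s hs).1
    have := N.mem_subspace_of_solution A B C hJ (K := c * r) hWd
      (fun s hs => (h₂ s (hJab hs) _ ((hWn s hs).trans_le hl₂)).le)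
      (fun s hs => (h₃ s (hJab hs) _ ((hWn s hs).trans_le hl₃)).le) (fun s hs => ?_) i ht₀ hmem ht
    · exact ⟨W t, ⟨⟨this, (hW t ht).1⟩, (hW t ht).1⟩, (hW t ht).2⟩
    · have hXn : ‖(((W s).1, 0, 0) : State m n l)‖ = ‖(W s).1‖ := by simp [Prod.norm_def]
      have hXr : ‖(W s).1‖ < r := (norm_fst_le _).trans_lt (hWn s hs)
      refine (h₆ s (hJab hs) _ (by rw [hXn]; exact hXr.trans_le hl₆)).trans ?_
      rw [hXn, pow_two, mul_assoc]
      exact mul_le_mul_of_nonneg_left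
        (mul_le_mul_of_nonneg_right hXr.le (norm_nonneg _)) hc

end Existence

end

theorem mainTheorem4 {m n l : ℕ} (S : SeparatedSystem m n l)
    (I : Set ℝ) (d : Set (State m n l)) (α β : ℝ) (P : ℕ)
    (hS : S.Assumption I d α β P)
    (p : ℕ) (hp : 2 ≤ p) (hpP : p ≤ P)
    (μ : ℝ) (hαμ : α < μ) (hμβ : μ < β) :
    ∃ (v : ℝ → State m n l → State m n l) (N : NormalForm m n l)
      (φ : ℝ → State m n l → State m n l),
      -- the system `u' = v(t,u)` is close to the given one
      IsOrder p I (fun t u => v t u - S.field t u) ∧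
      -- a normal form system and a coordinate transform
      N.IsAdmissible I ∧ IsNearIdentity I φ ∧
      -- the domains and the manifolds, over every compact time interval
      ∀ (δ : ℝ) (PA : Matrix (Fin m) (Fin m) ℝ) (Q : Matrix (Fin n) (Fin n) ℝ)
        (R : Matrix (Fin l) (Fin l) ℝ),
        0 ≤ δ → α < μ - δ → μ + δ < β →
        Jordanizes δ PA S.A → Jordanizes δ Q S.B → Jordanizes δ R S.C →
        ∀ a b : ℝ, a < b → Icc a b ⊆ I →
          ∃ (DD D : Set (State m n l)) (dμ : ℝ → Set (State m n l)),
            IsEmergencePreserving N α β μ δ Q R (Icc a b) DD ∧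
            IsStarShaped D ∧ D ⊆ DD ∧
            (∀ t ∈ Icc a b, IsDiffeoOnto P (φ t) D (dμ t) ∧ IsConnected (dμ t) ∧ dμ t ⊆ d) ∧
            (∃ r > 0, ∀ t ∈ Icc a b, Metric.ball 0 r ⊆ dμ t) ∧
            IsPushforward v φ (N.field S.A S.B S.C) (Icc a b) D ∧
            ∀ i : ManifoldKind,
              IsIntegralIn v (Icc a b) dμ (fun t => i.image φ DD D t) := by
  obtain ⟨N, φ, hN, hnear, hG0, hH0, hGc, hHc, hΦ, hφ, w₁, w₂, hw₁, hw₂, hw⟩ :=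
    hS.exists_conjugacy hp hpP
  have hP : 1 ≤ P := by omega
  have hdiff : ∀ t, Differentiable ℝ (φ t) := fun t =>
    (hφ t).differentiable (by exact_mod_cast Nat.one_le_iff_ne_zero.1 hP)
  have h0 : ∀ t ∈ I, φ t 0 = 0 := fun t ht => by
    simpa using hnear.near_identity.apply_zero ht
  have hid : ∀ t ∈ I, fderiv ℝ (φ t) 0 = ContinuousLinearMap.id ℝ (State m n l) := by
    intro t ht
    have h := (hnear.near_identity.hasFDerivAt_zero ht).add (hasFDerivAt_id (𝕜 := ℝ) 0)
    rw [zero_add] at h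
    refine (h.congr_of_eventuallyEq (Filter.Eventually.of_forall fun U => ?_)).fderiv
    simp
  have hv := fun t U => pushforwardField_apply (N.field S.A S.B S.C) S.field (hdiff t) (U := U)
  refine ⟨pushforwardField φ (N.field S.A S.B S.C) S.field, N, φ, ?_, hN, hnear, ?_⟩
  · refine isOrder_sub_of_conjugacy hS.time_open hΦ (fun t _ => hdiff t) h0 hid hw₁ hw₂ ?_
    intro t ht U hU
    rw [hv t U hU, hw t ht U]
  · intro δ _ Q R hδ hα hβ _ _ _ a b _ hab
    exact N.exists_domains hP hS.domain_open hS.zero_mem hS.time_open hN hG0 hH0 hGc hHc hΦ hφ h0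
      hid (fun t _ U hU => hv t U hU) hδ hα hβ Q R hab
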